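/- Let $n\ge 3$ and $a<b$. An $n$-ribbon surface is a family $f=(f_0,\dots,f_n)$ of smooth ($C^\infty$) curves $f_i:[a,b]\to\mathbb R^3$; a dot denotes $d/dt$, $\Delta f_i=f_{i+1}-f_i$, and $(u,v,w)$ is the determinant of three vectors. A flexion of $f$ is a family $\gamma(\lambda)$, $\lambda\in[0,\varepsilon]$, $\varepsilon>0$, of $n$-ribbon surfaces on $[a,b]$, jointly smooth in $(\lambda,t)\in[0,\varepsilon]\times[a,b]$, with $\gamma(0)=f$, along which the quantities $$|\dot f_i|,\quad |\Delta f_i|,\quad \langle\dot f_i,\Delta f_{i-1}\rangle,\quad \langle\dot f_i,\Delta f_i\rangle,\quad \langle\dot f_i,\dot f_{i+1}\rangle$$ (for all admissible $i$ and all $t\in[a,b]$) do not depend on $\lambda$. The surface $f$ is called (finitely) flexible if it has a flexion such that for some $\lambda\in[0,\varepsilon]$ the surface $\gamma(\lambda)$ is not the image of $f$ under an isometry of $\mathbb R^3$. Let $f$ be an $n$-ribbon surface such that for all $t\in[a,b]$ and all $1\le i\le n-1$ 1. $\dot f_i(t)$, $\Delta f_{i-1}(t)$, $\Delta f_i(t)$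 are not coplanar, and 2. $(\dot f_i(t),\ddot f_i(t),\Delta f_i(t))\neq 0$. Then $f$ is flexible if and only if every $3$-ribbon surface $(f_k,f_{k+1},f_{k+2},f_{k+3})$, $0\le k\le n-3$, contained in it is flexible. -/

import Mathlib

open Set
open scoped ContDiff InnerProductSpace

/-- Euclidean three-space. -/
abbrev E3 : Type := EuclideanSpace ℝ (Fin 3)

namespace Ribbon

/-- The map `f : [a,b] × {0, …, n} → ℝ³`, written as a family of curves `f i : ℝ → ℝ³` of which only
the values on `[a,b]` matter, is an `n`-ribbon surface: every curve is smooth on the segment. -/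
structure IsSurface {n : ℕ} (a b : ℝ) (f : Fin (n + 1) → ℝ → E3) : Prop where
  lt : a < b
  smooth : ∀ i, ContDiffOn ℝ ∞ (f i) (Icc a b)

/-- The derivative with respect to `t` of a curve on the segment `[a,b]` (one-sided at the ends). -/
noncomputable def dot (a b : ℝ) (c : ℝ → E3) : ℝ → E3 :=
  derivWithin c (Icc a b)

/-- The difference `Δ f_i = f_{i+1} - f_i`, for `0 ≤ i < n`. -/
noncomputable def delta {n : ℕ} (f : Fin (n + 1) → ℝ → E3) (i : Fin n) (t : ℝ) : E3 :=
  f i.succ t - f i.castSucc t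

/-- Two surfaces have the same inner geometry: the quantities
`|ḟ_i|`, `|Δ f_i|`, `⟨ḟ_i, Δ f_{i-1}⟩`, `⟨ḟ_i, Δ f_i⟩`, `⟨ḟ_i, ḟ_{i+1}⟩` agree
for all admissible `i` and all `t ∈ [a,b]`. -/
structure SameInnerGeometry {n : ℕ} (a b : ℝ) (f g : Fin (n + 1) → ℝ → E3) : Prop where
  norm_dot : ∀ (i : Fin (n + 1)), ∀ t ∈ Icc a b,
    ‖dot a b (g i) t‖ = ‖dot a b (f i) t‖
  norm_delta : ∀ (i : Fin n), ∀ t ∈ Icc a b,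
    ‖delta g i t‖ = ‖delta f i t‖
  inner_dot_delta_prev : ∀ (i : Fin n), ∀ t ∈ Icc a b,
    ⟪dot a b (g i.succ) t, delta g i t⟫_ℝ = ⟪dot a b (f i.succ) t, delta f i t⟫_ℝ
  inner_dot_delta : ∀ (i : Fin n), ∀ t ∈ Icc a b,
    ⟪dot a b (g i.castSucc) t, delta g i t⟫_ℝ = ⟪dot a b (f i.castSucc) t, delta f i t⟫_ℝ
  inner_dot_dot : ∀ (i : Fin n), ∀ t ∈ Icc a b,
    ⟪dot a b (g i.castSucc) t, dot a b (g i.succ) t⟫_ℝ =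
      ⟪dot a b (f i.castSucc) t, dot a b (f i.succ) t⟫_ℝ

/-- A perturbation `γ` of `f`, parameterized by `[0,ε]`: a smooth curve of surfaces with
`γ 0 = f` (smooth jointly in the deformation parameter and in `t`). -/
structure IsPerturbation {n : ℕ} (a b ε : ℝ) (f : Fin (n + 1) → ℝ → E3)
    (γ : ℝ → Fin (n + 1) → ℝ → E3) : Prop where
  pos : 0 < ε
  smooth : ∀ i, ContDiffOn ℝ ∞ (fun p : ℝ × ℝ => γ p.1 i p.2) (Icc 0 ε ×ˢ Icc a b)
  start : ∀ i, ∀ t ∈ Icc a b, γ 0 i t = f i t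

/-- A flexion is a perturbation that does not change the inner geometry. -/
structure IsFlexion {n : ℕ} (a b ε : ℝ) (f : Fin (n + 1) → ℝ → E3)
    (γ : ℝ → Fin (n + 1) → ℝ → E3) : Prop extends IsPerturbation a b ε f γ where
  isometric : ∀ l ∈ Icc 0 ε, SameInnerGeometry a b f (γ l)

/-- Two surfaces differ by an isometry of the ambient space. -/
def Congruent {n : ℕ} (a b : ℝ) (f g : Fin (n + 1) → ℝ → E3) : Prop :=
  ∃ T : E3 ≃ᵃⁱ[ℝ] E3, ∀ i, ∀ t ∈ Icc a b, g i t = T (f i t)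

/-- (Finite) flexibility: there is a flexion that is not merely a motion of the whole surface by
isometries of the ambient space. -/
def Flexible {n : ℕ} (a b : ℝ) (f : Fin (n + 1) → ℝ → E3) : Prop :=
  ∃ (ε : ℝ) (γ : ℝ → Fin (n + 1) → ℝ → E3),
    IsFlexion a b ε f γ ∧ ∃ l ∈ Icc 0 ε, ¬ Congruent a b f (γ l)

/-- The `m`-ribbon surface formed by the consecutive curves `f_k, …, f_{k+m}` of `f`. -/
def sub {n : ℕ} (f : Fin (n + 1) → ℝ → E3) (k m : ℕ) (h : k + m ≤ n) :
    Fin (m + 1) → ℝ → E3 :=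
  fun j => f ⟨k + j.val, by omega⟩

end Ribbon

/-! Along a flexion the inner geometry of each ribbon is fixed, and so is its orientation: the
square of the determinant (ḟ_i, Δf_i, ḟ_{i+1}) is a Gram determinant of inner-geometric quantities,
and by continuity in λ the determinant cannot change sign. What remains free at a time t is the fold
between adjacent ribbons, measured by `bend`, the product of the two rulings that leave the common
curve.

The basic computation is `vertexKnown`. At a fixed t, the inner geometry of two adjacent ribbons,
their `bend` and the determinant `vdet` (whose square is a polynomial in the bend) determine the
velocity, acceleration and jerk of the outer curve c₂ in the frame given by ċ₁, c₂ - c₁ and their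
cross product. The next ruling c₃ - c₂ has fixed products with itself, ċ₂ and c̈₂; hence `adet`² is
determined, and once its sign is fixed so are the ruling and the next bend, because ċ₂ and c̈₂ are
independent. All this uses only field operations, so it is done for an arbitrary class of functions
closed under them (`IsFieldlike`). The class is later taken to be the constants, and then the
analytic functions of the bend.

With constants: if one bend does not change, its neighbours do not (`bend_eq_start`), so no bend
changes, and the flexion is a motion (`congruent_of_bend`). A nontrivial flexion therefore changes
every bend and restricts to a nontrivial flexion of each 3-ribbon subsurface.

With analytic functions: suppose that f_0, …, f_{j+2} flex and that f_j, …, f_{j+3} have a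
nontrivial flexion. `exists_ruling` carries the ruling f_{j+3} - f_{j+2} along the first flexion,
keeping its products with itself and with the velocity and acceleration of f_{j+2}. The new ribbon
is isometric to the old one as soon as the speed |ḟ_{j+3} - ḟ_{j+2}| is kept
(`isoRibbon_of_sameRuling`). At each t the square of this speed is an analytic function of the bend,
the same for both deformations (`Deforms.speed_eq`). The second flexion makes it constant on an
interval of bends, so it is constant by the identity theorem. An interval is needed at every t; it
is provided by a linear ODE in t for the difference of two bends (`bend_eq_of_eq`): a bend that
changes at one time changes at all times. Induction on j finishes the proof. -/

namespace Ribbon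

/-! ### Cross products and Gram identities. -/

/-- The cross product of Euclidean three-space. -/
noncomputable def cross (x y : E3) : E3 :=
  !₂[x 1 * y 2 - x 2 * y 1, x 2 * y 0 - x 0 * y 2, x 0 * y 1 - x 1 * y 0]

lemma inner_coord (x y : E3) : ⟪x, y⟫_ℝ = x 0 * y 0 + x 1 * y 1 + x 2 * y 2 := by
  simp [PiLp.inner_apply, Fin.sum_univ_three]; ring

@[simp] lemma cross_zero_coord (x y : E3) : cross x y 0 = x 1 * y 2 - x 2 * y 1 := by simp [cross]
@[simp] lemma cross_one_coord (x y : E3) : cross x y 1 = x 2 * y 0 - x 0 * y 2 := by simp [cross]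
@[simp] lemma cross_two_coord (x y : E3) : cross x y 2 = x 0 * y 1 - x 1 * y 0 := by simp [cross]

lemma ext_coord {x y : E3} (h0 : x 0 = y 0) (h1 : x 1 = y 1) (h2 : x 2 = y 2) : x = y := by
  ext i; fin_cases i <;> assumption

lemma cross_add_left (x y z : E3) : cross (x + y) z = cross x z + cross y z := by
  apply ext_coord <;> simp <;> ring
lemma cross_add_right (x y z : E3) : cross x (y + z) = cross x y + cross x z := by
  apply ext_coord <;> simp <;> ring
lemma cross_smul_left (r : ℝ) (x y : E3) : cross (r • x) y = r • cross x y := by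
  apply ext_coord <;> simp <;> ring
lemma cross_smul_right (r : ℝ) (x y : E3) : cross x (r • y) = r • cross x y := by
  apply ext_coord <;> simp <;> ring

/-- The cross product as a continuous bilinear map. -/
noncomputable def crossL : E3 →L[ℝ] E3 →L[ℝ] E3 :=
  LinearMap.toContinuousLinearMap
    ((LinearMap.toContinuousLinearMap : (E3 →ₗ[ℝ] E3) ≃ₗ[ℝ] (E3 →L[ℝ] E3)).toLinearMap ∘ₗ
      LinearMap.mk₂ ℝ cross cross_add_left cross_smul_left cross_add_right cross_smul_right)

lemma inner_cross_left (x y : E3) : ⟪x, cross x y⟫_ℝ = 0 := by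
  simp only [inner_coord, cross_zero_coord, cross_one_coord, cross_two_coord]; ring
lemma inner_cross_right (x y : E3) : ⟪y, cross x y⟫_ℝ = 0 := by
  simp only [inner_coord, cross_zero_coord, cross_one_coord, cross_two_coord]; ring

lemma inner_cross_cross (x y z w : E3) :
    ⟪cross x y, cross z w⟫_ℝ = ⟪x, z⟫_ℝ * ⟪y, w⟫_ℝ - ⟪x, w⟫_ℝ * ⟪y, z⟫_ℝ := by
  simp only [inner_coord, cross_zero_coord, cross_one_coord, cross_two_coord]; ring

/-- The square of the determinant is the Gram determinant. -/
lemma det_sq (x y z : E3) : ⟪cross x y, z⟫_ℝ ^ 2 =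
    ⟪x, x⟫_ℝ * (⟪y, y⟫_ℝ * ⟪z, z⟫_ℝ - ⟪y, z⟫_ℝ ^ 2)
      - ⟪x, y⟫_ℝ * (⟪x, y⟫_ℝ * ⟪z, z⟫_ℝ - ⟪y, z⟫_ℝ * ⟪x, z⟫_ℝ)
      + ⟪x, z⟫_ℝ * (⟪x, y⟫_ℝ * ⟪y, z⟫_ℝ - ⟪y, y⟫_ℝ * ⟪x, z⟫_ℝ) := by
  simp only [inner_coord, cross_zero_coord, cross_one_coord, cross_two_coord]; ring

/-- The Gram matrix of v, p, v × p splits into a 2 × 2 block of determinant |v × p|² and the entry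
|v × p|², so its inverse has the single denominator |v × p|². This and the next two identities
express products of y and z by their products with the frame. -/
lemma gram_inner (v p y z : E3) : ⟪cross v p, cross v p⟫_ℝ * ⟪y, z⟫_ℝ =
    ⟪p, p⟫_ℝ * (⟪y, v⟫_ℝ * ⟪z, v⟫_ℝ) - ⟪v, p⟫_ℝ * (⟪y, v⟫_ℝ * ⟪z, p⟫_ℝ + ⟪y, p⟫_ℝ * ⟪z, v⟫_ℝ)
      + ⟪v, v⟫_ℝ * (⟪y, p⟫_ℝ * ⟪z, p⟫_ℝ) + ⟪y, cross v p⟫_ℝ * ⟪z, cross v p⟫_ℝ := by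
  simp only [inner_coord, cross_zero_coord, cross_one_coord, cross_two_coord]; ring

lemma gram_cross_left (v p y z : E3) : ⟪cross v p, cross v p⟫_ℝ * ⟪cross y z, v⟫_ℝ =
    ⟪v, v⟫_ℝ * (⟪y, p⟫_ℝ * ⟪z, cross v p⟫_ℝ - ⟪y, cross v p⟫_ℝ * ⟪z, p⟫_ℝ)
      + ⟪v, p⟫_ℝ * (⟪y, cross v p⟫_ℝ * ⟪z, v⟫_ℝ - ⟪y, v⟫_ℝ * ⟪z, cross v p⟫_ℝ) := by
  simp only [inner_coord, cross_zero_coord, cross_one_coord, cross_two_coord]; ring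

lemma gram_cross_right (v p y z : E3) : ⟪cross v p, cross v p⟫_ℝ * ⟪cross y z, p⟫_ℝ =
    ⟪p, p⟫_ℝ * (⟪y, cross v p⟫_ℝ * ⟪z, v⟫_ℝ - ⟪y, v⟫_ℝ * ⟪z, cross v p⟫_ℝ)
      + ⟪v, p⟫_ℝ * (⟪y, p⟫_ℝ * ⟪z, cross v p⟫_ℝ - ⟪y, cross v p⟫_ℝ * ⟪z, p⟫_ℝ) := by
  simp only [inner_coord, cross_zero_coord, cross_one_coord, cross_two_coord]; ring

/-- Expansion of a vector in the basis reciprocal to `x, y, z`. -/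
lemma det_smul (x y z s : E3) : ⟪cross x y, z⟫_ℝ • s =
    ⟪s, x⟫_ℝ • cross y z + ⟪s, y⟫_ℝ • cross z x + ⟪s, z⟫_ℝ • cross x y := by
  apply ext_coord <;>
    simp only [inner_coord, cross_zero_coord, cross_one_coord, cross_two_coord,
      PiLp.add_apply, PiLp.smul_apply, smul_eq_mul] <;> ring

lemma eq_of_inner_eq {x y z s s' : E3} (h : ⟪cross x y, z⟫_ℝ ≠ 0) (hx : ⟪s, x⟫_ℝ = ⟪s', x⟫_ℝ)
    (hy : ⟪s, y⟫_ℝ = ⟪s', y⟫_ℝ) (hz : ⟪s, z⟫_ℝ = ⟪s', z⟫_ℝ) : s = s' := by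
  have h1 := det_smul x y z s
  rw [hx, hy, hz, ← det_smul] at h1
  exact smul_right_injective _ h h1

lemma det_ne_zero_of_linearIndependent {x y z : E3} (h : LinearIndependent ℝ ![x, y, z]) :
    ⟪cross x y, z⟫_ℝ ≠ 0 := by
  have h1 := h.map' (WithLp.linearEquiv 2 ℝ (Fin 3 → ℝ)).toLinearMap (LinearEquiv.ker _)
  have h2 : LinearIndependent ℝ (Matrix.of ![⇑x, ⇑y, ⇑z]).row := by
    have e : (Matrix.of ![⇑x, ⇑y, ⇑z]).row =
        ⇑(WithLp.linearEquiv 2 ℝ (Fin 3 → ℝ)).toLinearMap ∘ ![x, y, z] := by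
      ext i j
      fin_cases i <;> rfl
    rw [e]
    exact h1
  have h3 := (Matrix.isUnit_iff_isUnit_det _).1 (Matrix.linearIndependent_rows_iff_isUnit.1 h2)
  convert h3.ne_zero using 1
  rw [Matrix.det_fin_three]
  simp [inner_coord]
  ring

lemma det_rotate (x y z : E3) : ⟪cross x y, z⟫_ℝ = ⟪cross y z, x⟫_ℝ := by
  simp only [inner_coord, cross_zero_coord, cross_one_coord, cross_two_coord]; ring

lemma det_swap (x y z : E3) : ⟪cross x y, z⟫_ℝ = -⟪cross x z, y⟫_ℝ := by
  simp only [inner_coord, cross_zero_coord, cross_one_coord, cross_two_coord]; ring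

/-! ### Vectors with known coordinates in a moving frame. -/

/-- A class of real functions on an index type that contains the constants and is closed
under the field operations. -/
structure IsFieldlike {I : Type*} (A : (I → ℝ) → Prop) : Prop where
  const : ∀ r, A fun _ => r
  add : ∀ {x y}, A x → A y → A fun i => x i + y i
  mul : ∀ {x y}, A x → A y → A fun i => x i * y i
  inv : ∀ {x}, A x → (∀ i, x i ≠ 0) → A fun i => (x i)⁻¹

namespace IsFieldlike
variable {I : Type*} {A : (I → ℝ) → Prop}

lemma neg (hA : IsFieldlike A) {x : I → ℝ} (hx : A x) : A fun i => -x i := by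
  simpa using hA.mul (hA.const (-1)) hx

lemma sub (hA : IsFieldlike A) {x y : I → ℝ} (hx : A x) (hy : A y) : A fun i => x i - y i := by
  simpa [sub_eq_add_neg] using hA.add hx (hA.neg hy)

/-- Division: the Gram identities hold after multiplication by |v × p|², and this removes the
factor. -/
lemma of_mul (hA : IsFieldlike A) {x y : I → ℝ} (hx : A x) (h0 : ∀ i, x i ≠ 0)
    (hxy : A fun i => x i * y i) : A y := by
  have := hA.mul (hA.inv hx h0) hxy
  convert this using 2 with i
  rw [inv_mul_cancel_left₀ (h0 i)]

end IsFieldlike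

/-- A family of moving pairs `v, p` of independent vectors whose Gram matrix is in the class `A`. -/
structure IsFrame {I : Type*} (A : (I → ℝ) → Prop) (v p : I → E3) : Prop where
  fieldlike : IsFieldlike A
  left : A fun i => ⟪v i, v i⟫_ℝ
  right : A fun i => ⟪p i, p i⟫_ℝ
  mixed : A fun i => ⟪v i, p i⟫_ℝ
  ne_zero : ∀ i, cross (v i) (p i) ≠ 0

/-- Families of vectors whose coordinates with respect to the frame `v, p, v × p` are in `A`. -/
structure InFrame {I : Type*} (A : (I → ℝ) → Prop) (v p : I → E3) (y : I → E3) : Prop where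
  left : A fun i => ⟪y i, v i⟫_ℝ
  right : A fun i => ⟪y i, p i⟫_ℝ
  normal : A fun i => ⟪y i, cross (v i) (p i)⟫_ℝ

namespace IsFrame
variable {I : Type*} {A : (I → ℝ) → Prop} {v p : I → E3}

lemma gram (h : IsFrame A v p) : A fun i => ⟪cross (v i) (p i), cross (v i) (p i)⟫_ℝ := by
  have := h.fieldlike.sub (h.fieldlike.mul h.left h.right) (h.fieldlike.mul h.mixed h.mixed)
  convert this using 2 with i
  rw [inner_cross_cross, real_inner_comm (v i) (p i)]

lemma gram_ne (h : IsFrame A v p) (i : I) : ⟪cross (v i) (p i), cross (v i) (p i)⟫_ℝ ≠ 0 :=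
  inner_self_ne_zero.2 (h.ne_zero i)

lemma inner (h : IsFrame A v p) {y z : I → E3} (hy : InFrame A v p y) (hz : InFrame A v p z) :
    A fun i => ⟪y i, z i⟫_ℝ := by
  have hA := h.fieldlike
  refine hA.of_mul h.gram h.gram_ne ?_
  simp only [gram_inner]
  exact hA.add (hA.add (hA.sub (hA.mul h.right (hA.mul hy.left hz.left))
    (hA.mul h.mixed (hA.add (hA.mul hy.left hz.right) (hA.mul hy.right hz.left))))
    (hA.mul h.left (hA.mul hy.right hz.right))) (hA.mul hy.normal hz.normal)

/-- The components along v and p come from the Gram identities; the one along v × p is Lagrange's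
identity and needs no division. -/
lemma cross (h : IsFrame A v p) {y z : I → E3} (hy : InFrame A v p y) (hz : InFrame A v p z) :
    InFrame A v p fun i => cross (y i) (z i) := by
  have hA := h.fieldlike
  refine ⟨hA.of_mul h.gram h.gram_ne ?_, hA.of_mul h.gram h.gram_ne ?_, ?_⟩
  · simp only [gram_cross_left]
    exact hA.add (hA.mul h.left (hA.sub (hA.mul hy.right hz.normal) (hA.mul hy.normal hz.right)))
      (hA.mul h.mixed (hA.sub (hA.mul hy.normal hz.left) (hA.mul hy.left hz.normal)))
  · simp only [gram_cross_right]
    exact hA.add (hA.mul h.right (hA.sub (hA.mul hy.normal hz.left) (hA.mul hy.left hz.normal)))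
      (hA.mul h.mixed (hA.sub (hA.mul hy.right hz.normal) (hA.mul hy.normal hz.right)))
  · simp only [inner_cross_cross]
    exact hA.sub (hA.mul hy.left hz.right) (hA.mul hy.right hz.left)

lemma add (h : IsFrame A v p) {y z : I → E3} (hy : InFrame A v p y) (hz : InFrame A v p z) :
    InFrame A v p fun i => y i + z i := by
  have hA := h.fieldlike
  constructor <;> simp only [inner_add_left]
  exacts [hA.add hy.left hz.left, hA.add hy.right hz.right, hA.add hy.normal hz.normal]

lemma smul (h : IsFrame A v p) {r : I → ℝ} {y : I → E3} (hr : A r) (hy : InFrame A v p y) :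
    InFrame A v p fun i => r i • y i := by
  have hA := h.fieldlike
  constructor <;> simp only [real_inner_smul_left]
  exacts [hA.mul hr hy.left, hA.mul hr hy.right, hA.mul hr hy.normal]

lemma neg (h : IsFrame A v p) {y : I → E3} (hy : InFrame A v p y) :
    InFrame A v p fun i => -y i := by
  simpa using h.smul (h.fieldlike.const (-1)) hy

lemma sub (h : IsFrame A v p) {y z : I → E3} (hy : InFrame A v p y) (hz : InFrame A v p z) :
    InFrame A v p fun i => y i - z i := by
  simpa [sub_eq_add_neg] using h.add hy (h.neg hz)

lemma mem_left (h : IsFrame A v p) : InFrame A v p v := by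
  refine ⟨h.left, h.mixed, ?_⟩
  simpa only [inner_cross_left] using h.fieldlike.const 0

lemma mem_right (h : IsFrame A v p) : InFrame A v p p := by
  refine ⟨?_, h.right, ?_⟩
  · simpa only [real_inner_comm] using h.mixed
  · simpa only [inner_cross_right] using h.fieldlike.const 0

/-- A vector whose products with a basis are known is known. -/
lemma of_inner (h : IsFrame A v p) {x y z s : I → E3} (hx : InFrame A v p x)
    (hy : InFrame A v p y) (hz : InFrame A v p z) (h0 : ∀ i, ⟪Ribbon.cross (x i) (y i), z i⟫_ℝ ≠ 0)
    (hsx : A fun i => ⟪s i, x i⟫_ℝ) (hsy : A fun i => ⟪s i, y i⟫_ℝ)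
    (hsz : A fun i => ⟪s i, z i⟫_ℝ) : InFrame A v p s := by
  have h1 : InFrame A v p fun i => (⟪Ribbon.cross (x i) (y i), z i⟫_ℝ)⁻¹ •
      (⟪Ribbon.cross (x i) (y i), z i⟫_ℝ • s i) := by
    simp only [det_smul]
    exact h.smul (h.fieldlike.inv (h.inner (h.cross hx hy) hz) h0)
      (h.add (h.add (h.smul hsx (h.cross hy hz)) (h.smul hsy (h.cross hz hx)))
        (h.smul hsz (h.cross hx hy)))
  convert h1 using 2 with i
  rw [inv_smul_smul₀ (h0 i)]

end IsFrame

end Ribbon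
namespace Ribbon

/-! ### Differentiation on a closed segment. -/

section Calculus
variable {a b t : ℝ}

lemma hasDerivWithinAt_dot {c : ℝ → E3} (hc : ContDiffOn ℝ ∞ c (Icc a b)) (ht : t ∈ Icc a b) :
    HasDerivWithinAt c (dot a b c t) (Icc a b) t :=
  ((hc.differentiableOn (by simp)) t ht).hasDerivWithinAt

lemma contDiffOn_dot {c : ℝ → E3} (hab : a < b) (hc : ContDiffOn ℝ ∞ c (Icc a b)) :
    ContDiffOn ℝ ∞ (dot a b c) (Icc a b) :=
  hc.derivWithin (uniqueDiffOn_Icc hab) (by simp)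

lemma dot_eq {c : ℝ → E3} {d : E3} (hab : a < b) (ht : t ∈ Icc a b)
    (h : HasDerivWithinAt c d (Icc a b) t) : dot a b c t = d :=
  h.derivWithin (uniqueDiffOn_Icc hab t ht)

lemma dot_congr {c d : ℝ → E3} (h : ∀ s ∈ Icc a b, c s = d s) (ht : t ∈ Icc a b) :
    dot a b c t = dot a b d t :=
  derivWithin_congr h (h t ht)

lemma dot_sub {c d : ℝ → E3} (hab : a < b) (hc : ContDiffOn ℝ ∞ c (Icc a b))
    (hd : ContDiffOn ℝ ∞ d (Icc a b)) (ht : t ∈ Icc a b) :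
    dot a b (fun s => c s - d s) t = dot a b c t - dot a b d t :=
  dot_eq hab ht ((hasDerivWithinAt_dot hc ht).sub (hasDerivWithinAt_dot hd ht))

lemma dot_add {c d : ℝ → E3} (hab : a < b) (hc : ContDiffOn ℝ ∞ c (Icc a b))
    (hd : ContDiffOn ℝ ∞ d (Icc a b)) (ht : t ∈ Icc a b) :
    dot a b (fun s => c s + d s) t = dot a b c t + dot a b d t :=
  dot_eq hab ht ((hasDerivWithinAt_dot hc ht).add (hasDerivWithinAt_dot hd ht))

lemma contDiff_cross : ContDiff ℝ ∞ fun p : E3 × E3 => cross p.1 p.2 :=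
  crossL.isBoundedBilinearMap.contDiff

lemma ContDiffOn.cross {E : Type*} [NormedAddCommGroup E] [NormedSpace ℝ E] {s : Set E}
    {c d : E → E3} (hc : ContDiffOn ℝ ∞ c s) (hd : ContDiffOn ℝ ∞ d s) :
    ContDiffOn ℝ ∞ (fun x => cross (c x) (d x)) s :=
  contDiff_cross.comp_contDiffOn (hc.prodMk hd)

lemma dot_cross {c d : ℝ → E3} (hab : a < b) (hc : ContDiffOn ℝ ∞ c (Icc a b))
    (hd : ContDiffOn ℝ ∞ d (Icc a b)) (ht : t ∈ Icc a b) :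
    dot a b (fun s => cross (c s) (d s)) t =
      cross (dot a b c t) (d t) + cross (c t) (dot a b d t) := by
  refine dot_eq hab ht ?_
  have := crossL.hasDerivWithinAt_of_bilinear (hasDerivWithinAt_dot hc ht)
    (hasDerivWithinAt_dot hd ht)
  rw [add_comm]
  exact this

lemma hasDerivWithinAt_inner {c d : ℝ → E3} (hc : ContDiffOn ℝ ∞ c (Icc a b))
    (hd : ContDiffOn ℝ ∞ d (Icc a b)) (ht : t ∈ Icc a b) :
    HasDerivWithinAt (fun s => ⟪c s, d s⟫_ℝ)
      (⟪dot a b c t, d t⟫_ℝ + ⟪c t, dot a b d t⟫_ℝ) (Icc a b) t := by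
  rw [add_comm]
  exact (hasDerivWithinAt_dot hc ht).inner ℝ (hasDerivWithinAt_dot hd ht)

/-- One-sided derivatives on a nondegenerate segment are unique. This is how equalities of inner
geometry are differentiated in t, end points included. -/
lemma deriv_unique {x y : ℝ → ℝ} {x' y' : ℝ} (hab : a < b) (ht : t ∈ Icc a b)
    (h : ∀ s ∈ Icc a b, x s = y s) (hx : HasDerivWithinAt x x' (Icc a b) t)
    (hy : HasDerivWithinAt y y' (Icc a b) t) : x' = y' :=
  (uniqueDiffOn_Icc hab t ht).eq_deriv (Icc a b) hx (hy.congr h (h t ht))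

end Calculus

/-! ### Families of ribbons with common inner geometry. -/

section Families
variable {I : Type*} {a b : ℝ} {o : I}

/-- All members of the family agree with the member of index `o` on the segment `[a,b]`. -/
def IsConst (a b : ℝ) (o : I) (x : I → ℝ → ℝ) : Prop :=
  ∀ i, ∀ t ∈ Icc a b, x i t = x o t

/-- All members of the family are smooth on the segment `[a,b]`. -/
def IsSmooth (a b : ℝ) (c : I → ℝ → E3) : Prop :=
  ∀ i, ContDiffOn ℝ ∞ (c i) (Icc a b)

lemma IsSmooth.dot {c : I → ℝ → E3} (hab : a < b) (hc : IsSmooth a b c) :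
    IsSmooth a b fun i => dot a b (c i) := fun i => contDiffOn_dot hab (hc i)

lemma IsSmooth.sub {c d : I → ℝ → E3} (hc : IsSmooth a b c) (hd : IsSmooth a b d) :
    IsSmooth a b fun i t => c i t - d i t := fun i => (hc i).sub (hd i)

lemma IsSmooth.cross {c d : I → ℝ → E3} (hc : IsSmooth a b c) (hd : IsSmooth a b d) :
    IsSmooth a b fun i t => cross (c i t) (d i t) := fun i => ContDiffOn.cross (hc i) (hd i)

/-- Fieldlike classes contain the constants, so inner geometry and its t-derivatives enter the frame
calculus without further hypotheses. -/
lemma IsConst.mem {A : (I → ℝ) → Prop} (hA : IsFieldlike A) {x : I → ℝ → ℝ}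
    (hx : IsConst a b o x) {t : ℝ} (ht : t ∈ Icc a b) : A fun i => x i t := by
  have : (fun i => x i t) = fun _ => x o t := funext fun i => hx i t ht
  rw [this]
  exact hA.const _

lemma IsConst.congr {x y : I → ℝ → ℝ} (hx : IsConst a b o x)
    (h : ∀ i, ∀ t ∈ Icc a b, y i t = x i t) : IsConst a b o y := fun i t ht => by
  rw [h i t ht, h o t ht, hx i t ht]

lemma IsConst.add {x y : I → ℝ → ℝ} (hx : IsConst a b o x) (hy : IsConst a b o y) :
    IsConst a b o fun i t => x i t + y i t := fun i t ht => by
  simp only [hx i t ht, hy i t ht]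

lemma IsConst.sub {x y : I → ℝ → ℝ} (hx : IsConst a b o x) (hy : IsConst a b o y) :
    IsConst a b o fun i t => x i t - y i t := fun i t ht => by
  simp only [hx i t ht, hy i t ht]

lemma IsConst.neg {x : I → ℝ → ℝ} (hx : IsConst a b o x) :
    IsConst a b o fun i t => -x i t := fun i t ht => by
  simp only [hx i t ht]

lemma IsConst.inner_comm {x y : I → ℝ → E3} (h : IsConst a b o fun i t => ⟪x i t, y i t⟫_ℝ) :
    IsConst a b o fun i t => ⟪y i t, x i t⟫_ℝ := by
  simpa only [real_inner_comm] using h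

/-- `IsConst` speaks of the whole segment and so survives differentiation in t. Membership in a
fieldlike class is used at one fixed t and cannot be differentiated, which is why the two notions
are kept apart. -/
lemma IsConst.deriv (hab : a < b) {x y : I → ℝ → ℝ} (hx : IsConst a b o x)
    (h : ∀ i, ∀ t ∈ Icc a b, HasDerivWithinAt (x i) (y i t) (Icc a b) t) :
    IsConst a b o y := fun i t ht => deriv_unique hab ht (hx i) (h i t ht) (h o t ht)

lemma IsConst.inner_deriv (hab : a < b) {x y : I → ℝ → E3} (hx : IsSmooth a b x)
    (hy : IsSmooth a b y) (h : IsConst a b o fun i t => ⟪x i t, y i t⟫_ℝ) :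
    IsConst a b o fun i t => ⟪dot a b (x i) t, y i t⟫_ℝ + ⟪x i t, dot a b (y i) t⟫_ℝ :=
  h.deriv hab fun i _ ht => hasDerivWithinAt_inner (hx i) (hy i) ht

lemma IsConst.inner_self_deriv (hab : a < b) {x : I → ℝ → E3} (hx : IsSmooth a b x)
    (h : IsConst a b o fun i t => ⟪x i t, x i t⟫_ℝ) :
    IsConst a b o fun i t => ⟪dot a b (x i) t, x i t⟫_ℝ := by
  intro i s hs
  have := h.inner_deriv hab hx hx i s hs
  simp only [real_inner_comm (dot a b (x _) s)] at this ⊢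
  linarith

lemma IsConst.inner_deriv_two (hab : a < b) {x y : I → ℝ → E3} (hx : IsSmooth a b x)
    (hy : IsSmooth a b y) (h : IsConst a b o fun i t => ⟪x i t, y i t⟫_ℝ) :
    IsConst a b o fun i t => ⟪dot a b (dot a b (x i)) t, y i t⟫_ℝ +
      ⟪dot a b (x i) t, dot a b (y i) t⟫_ℝ +
      (⟪dot a b (x i) t, dot a b (y i) t⟫_ℝ + ⟪x i t, dot a b (dot a b (y i)) t⟫_ℝ) :=
  (h.inner_deriv hab hx hy).deriv hab fun i _ ht =>
    (hasDerivWithinAt_inner (hx.dot hab i) (hy i) ht).add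
      (hasDerivWithinAt_inner (hx i) (hy.dot hab i) ht)

/-- The inner geometry of the ribbon between `c i` and `d i`, and its orientation, do not
depend on `i`. -/
structure ConstRibbon (a b : ℝ) (o : I) (c d : I → ℝ → E3) : Prop where
  left : IsConst a b o fun i t => ⟪dot a b (c i) t, dot a b (c i) t⟫_ℝ
  right : IsConst a b o fun i t => ⟪dot a b (d i) t, dot a b (d i) t⟫_ℝ
  ruling : IsConst a b o fun i t => ⟪d i t - c i t, d i t - c i t⟫_ℝ
  left_ruling : IsConst a b o fun i t => ⟪dot a b (c i) t, d i t - c i t⟫_ℝ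
  right_ruling : IsConst a b o fun i t => ⟪dot a b (d i) t, d i t - c i t⟫_ℝ
  left_right : IsConst a b o fun i t => ⟪dot a b (c i) t, dot a b (d i) t⟫_ℝ
  orient : IsConst a b o fun i t => ⟪cross (dot a b (c i) t) (d i t - c i t), dot a b (d i) t⟫_ℝ

lemma ConstRibbon.symm {c d : I → ℝ → E3} (h : ConstRibbon a b o c d) :
    ConstRibbon a b o d c where
  left := h.right
  right := h.left
  ruling := h.ruling.congr fun i t _ => by rw [← neg_sub, inner_neg_neg]
  left_ruling := h.right_ruling.neg.congr fun i t _ => by rw [← neg_sub, inner_neg_right]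
  right_ruling := h.left_ruling.neg.congr fun i t _ => by rw [← neg_sub, inner_neg_right]
  left_right := h.left_right.inner_comm
  -- Reversing the ribbon exchanges the two velocities and negates the ruling; the two signs cancel.
  orient := h.orient.congr fun i t _ => by
    simp only [inner_coord, cross_zero_coord, cross_one_coord, cross_two_coord, PiLp.sub_apply]
    ring

/-- What the inner geometry of two adjacent ribbons and the angle between them determine. -/
structure VertexKnown (a b : ℝ) (A : (I → ℝ) → Prop) (t : ℝ) (c₀ c₁ c₂ : I → ℝ → E3) : Prop where
  frame : IsFrame A (fun i => dot a b (c₁ i) t) (fun i => c₂ i t - c₁ i t)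
  prev : InFrame A (fun i => dot a b (c₁ i) t) (fun i => c₂ i t - c₁ i t)
    (fun i => c₀ i t - c₁ i t)
  acc : InFrame A (fun i => dot a b (c₁ i) t) (fun i => c₂ i t - c₁ i t)
    (fun i => dot a b (dot a b (c₁ i)) t)
  next_dot : InFrame A (fun i => dot a b (c₁ i) t) (fun i => c₂ i t - c₁ i t)
    (fun i => dot a b (c₂ i) t)
  next_acc : InFrame A (fun i => dot a b (c₁ i) t) (fun i => c₂ i t - c₁ i t)
    (fun i => dot a b (dot a b (c₂ i)) t)
  next_jerk : InFrame A (fun i => dot a b (c₁ i) t) (fun i => c₂ i t - c₁ i t)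
    (fun i => dot a b (dot a b (dot a b (c₂ i))) t)

/-- Write v = ċ₁, p = c₂ - c₁, q = c₀ - c₁, w = ċ₂, u = ċ₀, n = v × p. The bend and the determinant
place q in the frame of v and p; the inner geometry and orientation of the two ribbons then place w
and u. Each higher derivative is recovered from its products with a basis: v, p, q for the
derivatives of v, and v, p, n for those of w. Such a product is obtained by differentiating a
product that is constant in the index and subtracting the lower-order terms, which are already
known. -/
theorem vertexKnown {A : (I → ℝ) → Prop} {t : ℝ} {c₀ c₁ c₂ : I → ℝ → E3}
    (hab : a < b) (ht : t ∈ Icc a b) (hA : IsFieldlike A)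
    (h₀ : IsSmooth a b c₀) (h₁ : IsSmooth a b c₁) (h₂ : IsSmooth a b c₂)
    (hr₀ : ConstRibbon a b o c₁ c₀) (hr₁ : ConstRibbon a b o c₁ c₂)
    (hbend : A fun i => ⟪c₂ i t - c₁ i t, c₀ i t - c₁ i t⟫_ℝ)
    (hdet : A fun i => ⟪cross (dot a b (c₁ i) t) (c₂ i t - c₁ i t), c₀ i t - c₁ i t⟫_ℝ)
    (hdet0 : ∀ i, ⟪cross (dot a b (c₁ i) t) (c₂ i t - c₁ i t), c₀ i t - c₁ i t⟫_ℝ ≠ 0) :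
    VertexKnown a b A t c₀ c₁ c₂ := by
  -- derivatives of the rulings
  have dp : ∀ i, ∀ s ∈ Icc a b, dot a b (fun s => c₂ i s - c₁ i s) s =
      dot a b (c₂ i) s - dot a b (c₁ i) s := fun i s hs => dot_sub hab (h₂ i) (h₁ i) hs
  have dq : ∀ i, ∀ s ∈ Icc a b, dot a b (fun s => c₀ i s - c₁ i s) s =
      dot a b (c₀ i) s - dot a b (c₁ i) s := fun i s hs => dot_sub hab (h₀ i) (h₁ i) hs
  have sv := h₁.dot hab
  have sw := h₂.dot hab
  have sp := h₂.sub h₁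
  have sq := h₀.sub h₁
  have sv1 := sv.dot hab
  have sw1 := sw.dot hab
  have sn := sv.cross sp
  -- constant products
  have v1v := hr₁.left.inner_self_deriv hab sv
  have v1p : IsConst a b o fun i t => ⟪dot a b (dot a b (c₁ i)) t, c₂ i t - c₁ i t⟫_ℝ :=
    (((hr₁.left_ruling.inner_deriv hab sv sp).sub hr₁.left_right).add hr₁.left).congr
      fun i s hs => by
        rw [dp i s hs, inner_sub_right (dot a b (c₁ i) s) (dot a b (c₂ i) s)]; ring
  have v1q : IsConst a b o fun i t => ⟪dot a b (dot a b (c₁ i)) t, c₀ i t - c₁ i t⟫_ℝ :=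
    (((hr₀.left_ruling.inner_deriv hab sv sq).sub hr₀.left_right).add hr₀.left).congr
      fun i s hs => by
        rw [dq i s hs, inner_sub_right (dot a b (c₁ i) s) (dot a b (c₀ i) s)]; ring
  have w1p : IsConst a b o fun i t => ⟪dot a b (dot a b (c₂ i)) t, c₂ i t - c₁ i t⟫_ℝ :=
    (((hr₁.right_ruling.inner_deriv hab sw sp).sub hr₁.right).add hr₁.left_right).congr
      fun i s hs => by
        rw [dp i s hs, inner_sub_right (dot a b (c₂ i) s) (dot a b (c₂ i) s),
          real_inner_comm (dot a b (c₂ i) s) (dot a b (c₁ i) s)]; ring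
  have nw : IsConst a b o fun i t =>
      ⟪dot a b (c₂ i) t, cross (dot a b (c₁ i) t) (c₂ i t - c₁ i t)⟫_ℝ := hr₁.orient.inner_comm
  have dn : ∀ i, ∀ s ∈ Icc a b, dot a b (fun s => cross (dot a b (c₁ i) s) (c₂ i s - c₁ i s)) s =
      cross (dot a b (dot a b (c₁ i)) s) (c₂ i s - c₁ i s) +
        cross (dot a b (c₁ i) s) (dot a b (c₂ i) s - dot a b (c₁ i) s) := fun i s hs => by
    rw [dot_cross hab (sv i) (sp i) hs, dp i s hs]
  have dn2 : ∀ i, dot a b (dot a b (fun s => cross (dot a b (c₁ i) s) (c₂ i s - c₁ i s))) t =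
      (cross (dot a b (dot a b (dot a b (c₁ i))) t) (c₂ i t - c₁ i t) +
        cross (dot a b (dot a b (c₁ i)) t) (dot a b (c₂ i) t - dot a b (c₁ i) t)) +
      (cross (dot a b (dot a b (c₁ i)) t) (dot a b (c₂ i) t - dot a b (c₁ i) t) +
        cross (dot a b (c₁ i) t) (dot a b (dot a b (c₂ i)) t - dot a b (dot a b (c₁ i)) t)) := by
    intro i
    rw [dot_congr (dn i) ht, dot_add hab (ContDiffOn.cross (sv1 i) (sp i))
      (ContDiffOn.cross (sv i) ((sw i).sub (sv i))) ht, dot_cross hab (sv1 i) (sp i) ht,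
      dot_cross hab (sv i) ((sw i).sub (sv i)) ht, dp i t ht, dot_sub hab (sw i) (sv i) ht]
  -- the frame
  have F : IsFrame A (fun i => dot a b (c₁ i) t) (fun i => c₂ i t - c₁ i t) := by
    refine ⟨hA, hr₁.left.mem hA ht, hr₁.ruling.mem hA ht, hr₁.left_ruling.mem hA ht, ?_⟩
    intro i h
    exact hdet0 i (by simp [h])
  have mv := F.mem_left
  have mp := F.mem_right
  have mn := F.cross mv mp
  have mq : InFrame A (fun i => dot a b (c₁ i) t) (fun i => c₂ i t - c₁ i t)
      (fun i => c₀ i t - c₁ i t) :=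
    ⟨hr₀.left_ruling.inner_comm.mem hA ht, by simpa only [real_inner_comm] using hbend,
      by simpa only [real_inner_comm] using hdet⟩
  have mw : InFrame A (fun i => dot a b (c₁ i) t) (fun i => c₂ i t - c₁ i t)
      (fun i => dot a b (c₂ i) t) :=
    ⟨hr₁.left_right.inner_comm.mem hA ht, hr₁.right_ruling.mem hA ht, nw.mem hA ht⟩
  -- The basis v, q, v × q belongs to the other ribbon: products of u with these vectors are its
  -- inner geometry and orientation.
  have mu : InFrame A (fun i => dot a b (c₁ i) t) (fun i => c₂ i t - c₁ i t)
      (fun i => dot a b (c₀ i) t) := by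
    refine F.of_inner mv mq (F.cross mv mq) (fun i => ?_) (hr₀.left_right.inner_comm.mem hA ht)
      (hr₀.right_ruling.mem hA ht) (hr₀.orient.inner_comm.mem hA ht)
    refine inner_self_ne_zero.2 fun h => hdet0 i ?_
    rw [det_swap, h]
    simp
  have mv1 := F.of_inner mv mp mq hdet0 (v1v.mem hA ht) (v1p.mem hA ht) (v1q.mem hA ht)
  have mw1 : InFrame A (fun i => dot a b (c₁ i) t) (fun i => c₂ i t - c₁ i t)
      (fun i => dot a b (dot a b (c₂ i)) t) := by
    refine ⟨?_, w1p.mem hA ht, ?_⟩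
    -- Product rule solved for its leading term: ⟨ẇ, v⟩ is the derivative of ⟨w, v⟩ minus ⟨w, v̇⟩.
    · have := (hr₁.left_right.inner_comm.inner_deriv hab sw sv).mem hA ht
      simpa only [add_sub_cancel_right] using hA.sub this (F.inner mw mv1)
    · have := (nw.inner_deriv hab sw sn).mem hA ht
      simp only [dn _ t ht] at this
      simpa only [add_sub_cancel_right] using hA.sub this
        (F.inner mw (F.add (F.cross mv1 mp) (F.cross mv (F.sub mw mv))))
  have mv2 : InFrame A (fun i => dot a b (c₁ i) t) (fun i => c₂ i t - c₁ i t)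
      (fun i => dot a b (dot a b (dot a b (c₁ i))) t) := by
    refine F.of_inner mv mp mq hdet0 ?_ ?_ ?_
    · have := (v1v.inner_deriv hab sv1 sv).mem hA ht
      simpa only [add_sub_cancel_right] using hA.sub this (F.inner mv1 mv1)
    · have := (v1p.inner_deriv hab sv1 sp).mem hA ht
      simp only [dp _ t ht] at this
      simpa only [add_sub_cancel_right] using hA.sub this (F.inner mv1 (F.sub mw mv))
    · have := (v1q.inner_deriv hab sv1 sq).mem hA ht
      simp only [dq _ t ht] at this
      simpa only [add_sub_cancel_right] using hA.sub this (F.inner mv1 (F.sub mu mv))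
  have mw2 : InFrame A (fun i => dot a b (c₁ i) t) (fun i => c₂ i t - c₁ i t)
      (fun i => dot a b (dot a b (dot a b (c₂ i))) t) := by
    refine ⟨?_, ?_, ?_⟩
    -- The second derivative of ⟨w, v⟩ contains ⟨ẇ, v̇⟩ twice, so that term is subtracted twice.
    · have := (hr₁.left_right.inner_comm.inner_deriv_two hab sw sv).mem hA ht
      have := hA.sub (hA.sub this (hA.add (F.inner mw1 mv1) (F.inner mw mv2))) (F.inner mw1 mv1)
      simpa only [add_sub_cancel_right] using this
    · have := (w1p.inner_deriv hab sw1 sp).mem hA ht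
      simp only [dp _ t ht] at this
      simpa only [add_sub_cancel_right] using hA.sub this (F.inner mw1 (F.sub mw mv))
    · have := (nw.inner_deriv_two hab sw sn).mem hA ht
      simp only [dn2, dn _ t ht] at this
      have mn1 := F.add (F.cross mv1 mp) (F.cross mv (F.sub mw mv))
      have mn2 := F.add (F.add (F.cross mv2 mp) (F.cross mv1 (F.sub mw mv)))
        (F.add (F.cross mv1 (F.sub mw mv)) (F.cross mv (F.sub mw1 mv1)))
      have := hA.sub (hA.sub this (hA.add (F.inner mw1 mn1) (F.inner mw mn2))) (F.inner mw1 mn1)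
      simpa only [add_sub_cancel_right] using this
  exact ⟨F, mq, mv1, mw, mw1, mw2⟩

end Families
end Ribbon
namespace Ribbon

/-! ### From one fold to the next. -/

section Families
variable {I : Type*} {a b t : ℝ} {o : I} {A : (I → ℝ) → Prop} {c₀ c₁ c₂ c₃ : I → ℝ → E3}

/-- The product of the rulings at the middle curve of two adjacent ribbons. -/
noncomputable def bend (c₀ c₁ c₂ : ℝ → E3) (t : ℝ) : ℝ := ⟪c₂ t - c₁ t, c₀ t - c₁ t⟫_ℝ

/-- The determinant of the velocity of the middle curve and the rulings of two adjacent ribbons. -/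
noncomputable def vdet (a b : ℝ) (c₀ c₁ c₂ : ℝ → E3) (t : ℝ) : ℝ :=
  ⟪cross (dot a b c₁ t) (c₂ t - c₁ t), c₀ t - c₁ t⟫_ℝ

/-- The determinant of the velocity, the acceleration of the curve `c` and the ruling
towards the curve `d`. -/
noncomputable def adet (a b : ℝ) (c d : ℝ → E3) (t : ℝ) : ℝ :=
  ⟪cross (dot a b c t) (dot a b (dot a b c) t), d t - c t⟫_ℝ

lemma bend_comm (c₀ c₁ c₂ : ℝ → E3) (t : ℝ) : bend c₀ c₁ c₂ t = bend c₂ c₁ c₀ t :=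
  real_inner_comm _ _

lemma vdet_comm (a b : ℝ) (c₀ c₁ c₂ : ℝ → E3) (t : ℝ) :
    vdet a b c₀ c₁ c₂ t = -vdet a b c₂ c₁ c₀ t := det_swap _ _ _

lemma IsFieldlike.det_sq (hA : IsFieldlike A) {x y z : I → E3} (hxx : A fun i => ⟪x i, x i⟫_ℝ)
    (hyy : A fun i => ⟪y i, y i⟫_ℝ) (hzz : A fun i => ⟪z i, z i⟫_ℝ)
    (hxy : A fun i => ⟪x i, y i⟫_ℝ) (hyz : A fun i => ⟪y i, z i⟫_ℝ)
    (hxz : A fun i => ⟪x i, z i⟫_ℝ) : A fun i => ⟪cross (x i) (y i), z i⟫_ℝ ^ 2 := by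
  simp only [Ribbon.det_sq]
  simp only [pow_two]
  exact hA.add (hA.sub (hA.mul hxx (hA.sub (hA.mul hyy hzz) (hA.mul hyz hyz)))
    (hA.mul hxy (hA.sub (hA.mul hxy hzz) (hA.mul hyz hxz))))
    (hA.mul hxz (hA.sub (hA.mul hxy hyz) (hA.mul hyy hxz)))

/-- In the Gram matrix of the velocity and the two rulings the bend is the only entry not fixed by
the inner geometry. -/
theorem vdet_sq_mem (ht : t ∈ Icc a b) (hA : IsFieldlike A)
    (hr₀ : ConstRibbon a b o c₁ c₀) (hr₁ : ConstRibbon a b o c₁ c₂)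
    (hbend : A fun i => bend (c₀ i) (c₁ i) (c₂ i) t) :
    A fun i => vdet a b (c₀ i) (c₁ i) (c₂ i) t ^ 2 :=
  hA.det_sq (hr₁.left.mem hA ht) (hr₁.ruling.mem hA ht) (hr₀.ruling.mem hA ht)
    (hr₁.left_ruling.mem hA ht) hbend (hr₀.left_ruling.mem hA ht)

/-- Products of the velocity and acceleration of `c` and the ruling to `d` are constant. -/
structure ConstRuling (a b : ℝ) (o : I) (c d : I → ℝ → E3) : Prop where
  ruling : IsConst a b o fun i t => ⟪d i t - c i t, d i t - c i t⟫_ℝ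
  dot_ruling : IsConst a b o fun i t => ⟪d i t - c i t, dot a b (c i) t⟫_ℝ
  acc_ruling : IsConst a b o fun i t => ⟪d i t - c i t, dot a b (dot a b (c i)) t⟫_ℝ

/-- The product with the acceleration comes from differentiating ⟨c₂ - c₁, ċ₁⟩. -/
lemma ConstRibbon.constRuling (hab : a < b) (h₁ : IsSmooth a b c₁) (h₂ : IsSmooth a b c₂)
    (h : ConstRibbon a b o c₁ c₂) : ConstRuling a b o c₁ c₂ := by
  refine ⟨h.ruling, h.left_ruling.inner_comm, ?_⟩
  refine (((h.left_ruling.inner_comm.inner_deriv hab (h₂.sub h₁) (h₁.dot hab)).sub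
    h.left_right).add h.left).congr fun i s hs => ?_
  rw [dot_sub hab (h₂ i) (h₁ i) hs, inner_sub_left (dot a b (c₂ i) s),
    real_inner_comm (dot a b (c₁ i) s) (dot a b (c₂ i) s)]
  ring

/-- A Gram determinant again: the products of ċ₂ and c̈₂ are known from the preceding fold, those
with the new ruling are constant. -/
theorem VertexKnown.adet_sq_mem (ht : t ∈ Icc a b) (hV : VertexKnown a b A t c₀ c₁ c₂)
    (hr₂ : ConstRuling a b o c₂ c₃) : A fun i => adet a b (c₂ i) (c₃ i) t ^ 2 := by
  have F := hV.frame
  have hA := F.fieldlike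
  exact hA.det_sq (F.inner hV.next_dot hV.next_dot) (F.inner hV.next_acc hV.next_acc)
    (hr₂.ruling.mem hA ht) (F.inner hV.next_dot hV.next_acc)
    (hr₂.acc_ruling.inner_comm.mem hA ht) (hr₂.dot_ruling.inner_comm.mem hA ht)

/-- Once the sign of `adet` is settled, the new ruling has known products with the basis ċ₂, c̈₂, ċ₂
× c̈₂. -/
theorem VertexKnown.ruling_mem (ht : t ∈ Icc a b) (hV : VertexKnown a b A t c₀ c₁ c₂)
    (hr₂ : ConstRuling a b o c₂ c₃) (hdet : A fun i => adet a b (c₂ i) (c₃ i) t)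
    (h0 : ∀ i, cross (dot a b (c₂ i) t) (dot a b (dot a b (c₂ i)) t) ≠ 0) :
    InFrame A (fun i => dot a b (c₁ i) t) (fun i => c₂ i t - c₁ i t)
      (fun i => c₃ i t - c₂ i t) := by
  have F := hV.frame
  have hA := F.fieldlike
  exact F.of_inner hV.next_dot hV.next_acc (F.cross hV.next_dot hV.next_acc)
    (fun i => inner_self_ne_zero.2 (h0 i)) (hr₂.dot_ruling.mem hA ht) (hr₂.acc_ruling.mem hA ht)
    (by simpa only [adet, real_inner_comm] using hdet)

theorem VertexKnown.bend_mem (ht : t ∈ Icc a b) (hV : VertexKnown a b A t c₀ c₁ c₂)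
    (hr₂ : ConstRuling a b o c₂ c₃) (hdet : A fun i => adet a b (c₂ i) (c₃ i) t)
    (h0 : ∀ i, cross (dot a b (c₂ i) t) (dot a b (dot a b (c₂ i)) t) ≠ 0) :
    A fun i => bend (c₁ i) (c₂ i) (c₃ i) t := by
  have F := hV.frame
  have := F.inner (hV.ruling_mem ht hr₂ hdet h0) (F.neg F.mem_right)
  simpa only [bend, neg_sub] using this

/-- The speed of the ruling of the third ribbon is determined. -/
theorem VertexKnown.ruling_speed_mem (hab : a < b) (ht : t ∈ Icc a b)
    (h₂ : IsSmooth a b c₂) (h₃ : IsSmooth a b c₃)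
    (hV : VertexKnown a b A t c₀ c₁ c₂)
    (hr₂ : ConstRuling a b o c₂ c₃) (hdet : A fun i => adet a b (c₂ i) (c₃ i) t)
    (h0 : ∀ i, adet a b (c₂ i) (c₃ i) t ≠ 0) :
    A fun i => ⟪dot a b (c₃ i) t - dot a b (c₂ i) t, dot a b (c₃ i) t - dot a b (c₂ i) t⟫_ℝ := by
  have F := hV.frame
  have hA := F.fieldlike
  have sp := h₃.sub h₂
  have sw := h₂.dot hab
  have mp := hV.ruling_mem ht hr₂ hdet fun i h => h0 i (by simp [adet, h])
  have key : InFrame A (fun i => dot a b (c₁ i) t) (fun i => c₂ i t - c₁ i t)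
      fun i => dot a b (fun s => c₃ i s - c₂ i s) t := by
    -- The basis is ċ₂, c̈₂ and the ruling itself, independent since `adet` does not vanish. The
    -- product of the ruling's derivative with c̈₂ is where the jerk of c₂ enters.
    refine F.of_inner hV.next_dot hV.next_acc mp h0 ?_ ?_ ?_
    · have := (hr₂.dot_ruling.inner_deriv hab sp sw).mem hA ht
      simpa only [add_sub_cancel_right] using hA.sub this (hr₂.acc_ruling.mem hA ht)
    · have := (hr₂.acc_ruling.inner_deriv hab sp (sw.dot hab)).mem hA ht
      simpa only [add_sub_cancel_right] using hA.sub this (F.inner mp hV.next_jerk)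
    · exact (hr₂.ruling.inner_self_deriv hab sp).mem hA ht
  have := F.inner key key
  simpa only [dot_sub hab (h₃ _) (h₂ _) ht] using this

end Families

/-! ### The two fieldlike classes: constants and analytic functions of a parameter. -/

section Classes
variable {I : Type*}

/-- The families whose members all agree. -/
def Constant (x : I → ℝ) : Prop := ∃ r, ∀ i, x i = r

lemma isFieldlike_constant : IsFieldlike (Constant (I := I)) where
  const r := ⟨r, fun _ => rfl⟩
  add := by rintro x y ⟨r, hr⟩ ⟨s, hs⟩; exact ⟨r + s, fun i => by simp only [hr, hs]⟩
  mul := by rintro x y ⟨r, hr⟩ ⟨s, hs⟩; exact ⟨r * s, fun i => by simp only [hr, hs]⟩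
  inv := by rintro x ⟨r, hr⟩ _; exact ⟨r⁻¹, fun i => by simp only [hr]⟩

/-- The families that depend analytically on the parameter `h`. -/
def AnalyticIn (h : I → ℝ) (x : I → ℝ) : Prop :=
  ∃ ψ : ℝ → ℝ, AnalyticOnNhd ℝ ψ (range h) ∧ ∀ i, x i = ψ (h i)

lemma isFieldlike_analyticIn (h : I → ℝ) : IsFieldlike (AnalyticIn h) where
  const r := ⟨fun _ => r, analyticOnNhd_const, fun _ => rfl⟩
  add := by
    rintro x y ⟨ψ, hψ, hx⟩ ⟨χ, hχ, hy⟩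
    exact ⟨ψ + χ, hψ.add hχ, fun i => by simp [hx, hy]⟩
  mul := by
    rintro x y ⟨ψ, hψ, hx⟩ ⟨χ, hχ, hy⟩
    exact ⟨ψ * χ, hψ.mul hχ, fun i => by simp [hx, hy]⟩
  inv := by
    rintro x ⟨ψ, hψ, hx⟩ h0
    refine ⟨ψ⁻¹, hψ.inv ?_, fun i => by simp [hx]⟩
    rintro _ ⟨i, rfl⟩
    rw [← hx]
    exact h0 i

lemma AnalyticIn.self (h : I → ℝ) : AnalyticIn h h := ⟨id, analyticOnNhd_id, fun _ => rfl⟩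

/-- A family of constant sign is analytic if its square is. -/
lemma AnalyticIn.of_sq {h x : I → ℝ} (o : I) (hx : AnalyticIn h fun i => x i ^ 2)
    (hpos : ∀ i, 0 < x i * x o) : AnalyticIn h x := by
  obtain ⟨ψ, hψ, hx⟩ := hx
  have hsq : AnalyticIn h fun i => √(x i ^ 2) := by
    refine ⟨fun s => √(ψ s), ?_, fun i => by simp only [hx i]⟩
    rintro _ ⟨i, rfl⟩
    have hne : ψ (h i) ≠ 0 := by
      rw [← hx i]
      exact pow_ne_zero 2 (left_ne_zero_of_mul (hpos i).ne')
    exact (Real.contDiffAt_sqrt (n := ω) hne).analyticAt.comp (hψ _ ⟨i, rfl⟩)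
  have ho : x o ≠ 0 := left_ne_zero_of_mul (hpos o).ne'
  -- The constant factor is the common sign, read off at the index `o`.
  have := (isFieldlike_analyticIn h).mul ((isFieldlike_analyticIn h).const (x o / |x o|)) hsq
  convert this using 2 with i
  rw [Real.sqrt_sq_eq_abs]
  have ho' : |x o| ≠ 0 := abs_ne_zero.2 ho
  rw [div_mul_eq_mul_div, eq_div_iff ho']
  rcases lt_or_gt_of_ne ho with h1 | h1
  · have : x i < 0 := by
      by_contra h2
      nlinarith [hpos i]
    rw [abs_of_neg h1, abs_of_neg this]; ring
  · have : 0 < x i := by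
      by_contra h2
      nlinarith [hpos i]
    rw [abs_of_pos h1, abs_of_pos this]; ring

/-- The identity theorem for families that depend analytically on a parameter. -/
lemma AnalyticIn.eq_of_eq_on {h x : I → ℝ} (hx : AnalyticIn h x) (hc : IsPreconnected (range h))
    {J : Set I} {s r k : ℝ} (hsr : s < r) (hJ : Icc s r ⊆ h '' J) (hk : ∀ j ∈ J, x j = k) (i : I) :
    x i = k := by
  obtain ⟨ψ, hψ, hx⟩ := hx
  rw [hx]
  -- The identity theorem needs equality near one point; the midpoint of the interval of known
  -- values serves.
  have hm : (s + r) / 2 ∈ Ioo s r := ⟨by linarith, by linarith⟩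
  refine hψ.eqOn_of_preconnected_of_eventuallyEq (analyticOnNhd_const (v := k)) hc
    (z₀ := (s + r) / 2) ?_ ?_ ⟨i, rfl⟩
  · obtain ⟨j, -, hj⟩ := hJ (Ioo_subset_Icc_self hm)
    exact ⟨j, hj⟩
  · filter_upwards [Ioo_mem_nhds hm.1 hm.2] with z hz
    obtain ⟨j, hj, rfl⟩ := hJ (Ioo_subset_Icc_self hz)
    rw [← hx, hk j hj]

end Classes
end Ribbon
namespace Ribbon

/-! ### Joint smoothness and signs along a deformation. -/

section Joint
variable {a b ε : ℝ}

/-- Joint smoothness of a family of curves in the parameter and in `t`. -/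
def JointSmooth (a b ε : ℝ) (c : ℝ → ℝ → E3) : Prop :=
  ContDiffOn ℝ ∞ (fun p : ℝ × ℝ => c p.1 p.2) (Icc 0 ε ×ˢ Icc a b)

lemma JointSmooth.slice {c : ℝ → ℝ → E3} (hc : JointSmooth a b ε c) {l : ℝ} (hl : l ∈ Icc 0 ε) :
    ContDiffOn ℝ ∞ (c l) (Icc a b) :=
  ContDiffOn.comp (g := fun p : ℝ × ℝ => c p.1 p.2) (f := fun t => (l, t)) hc (contDiff_const.prodMk contDiff_id).contDiffOn fun _ ht => ⟨hl, ht⟩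

lemma JointSmooth.sub {c d : ℝ → ℝ → E3} (hc : JointSmooth a b ε c) (hd : JointSmooth a b ε d) :
    JointSmooth a b ε fun l t => c l t - d l t := ContDiffOn.sub hc hd

lemma JointSmooth.add {c d : ℝ → ℝ → E3} (hc : JointSmooth a b ε c) (hd : JointSmooth a b ε d) :
    JointSmooth a b ε fun l t => c l t + d l t := ContDiffOn.add hc hd

lemma JointSmooth.cross {c d : ℝ → ℝ → E3} (hc : JointSmooth a b ε c)
    (hd : JointSmooth a b ε d) : JointSmooth a b ε fun l t => cross (c l t) (d l t) :=
  ContDiffOn.cross hc hd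

lemma JointSmooth.mono {c : ℝ → ℝ → E3} (hc : JointSmooth a b ε c) {δ : ℝ} (h : δ ≤ ε) :
    JointSmooth a b δ c :=
  ContDiffOn.mono hc (prod_mono (Icc_subset_Icc_right h) Subset.rfl)

lemma JointSmooth.inner {c d : ℝ → ℝ → E3} (hc : JointSmooth a b ε c)
    (hd : JointSmooth a b ε d) :
    ContDiffOn ℝ ∞ (fun p : ℝ × ℝ => ⟪c p.1 p.2, d p.1 p.2⟫_ℝ) (Icc 0 ε ×ˢ Icc a b) :=
  ContDiffOn.inner ℝ hc hd

/-- The t-derivative is the derivative of the joint map within the rectangle in the direction (0,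
1). -/
lemma JointSmooth.dot {c : ℝ → ℝ → E3} (hε : 0 < ε) (hab : a < b) (hc : JointSmooth a b ε c) :
    JointSmooth a b ε fun l => dot a b (c l) := by
  have hU : UniqueDiffOn ℝ (Icc (0 : ℝ) ε ×ˢ Icc a b) :=
    (uniqueDiffOn_Icc hε).prod (uniqueDiffOn_Icc hab)
  have h1 : ContDiffOn ℝ ∞ (fun p => fderivWithin ℝ (fun p : ℝ × ℝ => c p.1 p.2)
      (Icc 0 ε ×ˢ Icc a b) p ((0 : ℝ), (1 : ℝ))) (Icc 0 ε ×ˢ Icc a b) :=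
    (ContDiffOn.fderivWithin (m := ∞) hc hU (by simp)).clm_apply contDiffOn_const
  refine h1.congr ?_
  rintro ⟨l, t⟩ ⟨hl, ht⟩
  refine dot_eq hab ht ?_
  have h2 : HasFDerivWithinAt (fun p : ℝ × ℝ => c p.1 p.2)
      (fderivWithin ℝ (fun p : ℝ × ℝ => c p.1 p.2) (Icc 0 ε ×ˢ Icc a b) (l, t))
      (Icc 0 ε ×ˢ Icc a b) (l, t) :=
    ((ContDiffOn.differentiableOn hc (by simp)) (l, t) ⟨hl, ht⟩).hasFDerivWithinAt
  have h3 : HasDerivWithinAt (fun s : ℝ => (l, s)) ((0 : ℝ), (1 : ℝ)) (Icc a b) t :=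
    (hasDerivWithinAt_const t _ l).prodMk (hasDerivWithinAt_id t _)
  exact h2.comp_hasDerivWithinAt t h3 fun s hs => ⟨hl, hs⟩

lemma continuousOn_param {x : ℝ → ℝ → ℝ}
    (hx : ContinuousOn (fun p : ℝ × ℝ => x p.1 p.2) (Icc 0 ε ×ˢ Icc a b)) {t s : ℝ}
    (ht : t ∈ Icc a b) (hs : s ≤ ε) : ContinuousOn (fun l => x l t) (Icc 0 s) :=
  hx.comp (Continuous.prodMk continuous_id continuous_const).continuousOn
    fun _ hl => ⟨⟨hl.1, hl.2.trans hs⟩, ht⟩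

/-- A continuous function on [0, s] with constant square cannot pass from x to -x without vanishing.
This fixes all the signs that Gram determinants leave open: the orientations of ribbons, `vdet` and
`adet`. -/
lemma eq_start_of_sq {x : ℝ → ℝ → ℝ}
    (hx : ContinuousOn (fun p : ℝ × ℝ => x p.1 p.2) (Icc 0 ε ×ˢ Icc a b)) {t s : ℝ}
    (ht : t ∈ Icc a b) (hs : s ∈ Icc 0 ε) (h : ∀ l ∈ Icc 0 s, x l t ^ 2 = x 0 t ^ 2) {l : ℝ}
    (hl : l ∈ Icc 0 s) : x l t = x 0 t := by
  by_cases h0 : x 0 t = 0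
  · have := h l hl
    rw [h0] at this ⊢
    simpa using this
  · exact isPreconnected_Icc.eq_of_sq_eq (continuousOn_param hx ht hs.2) continuousOn_const (fun l hl => h l hl)
      (fun _ => h0) (y := 0) ⟨le_rfl, hs.1⟩ rfl hl

/-- A function positive on the initial segment stays positive for small parameters. -/
lemma exists_shrink_pos {x : ℝ → ℝ → ℝ} (hε : 0 < ε)
    (hx : ContinuousOn (fun p : ℝ × ℝ => x p.1 p.2) (Icc 0 ε ×ˢ Icc a b))
    (h0 : ∀ t ∈ Icc a b, 0 < x 0 t) :
    ∃ δ, 0 < δ ∧ δ ≤ ε ∧ ∀ l ∈ Icc 0 δ, ∀ t ∈ Icc a b, 0 < x l t := by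
  set K : Set (ℝ × ℝ) := (Icc 0 ε ×ˢ Icc a b) ∩ {p | x p.1 p.2 ≤ 0} with hK
  have hKc : IsCompact K := by
    have : IsClosed K := hx.preimage_isClosed_of_isClosed (isClosed_Icc.prod isClosed_Icc) isClosed_Iic
    exact (isCompact_Icc.prod isCompact_Icc).of_isClosed_subset this inter_subset_left
  rcases K.eq_empty_or_nonempty with he | hne
  · refine ⟨ε, hε, le_rfl, fun l hl t ht => ?_⟩
    by_contra hn
    have : (l, t) ∈ K := ⟨⟨hl, ht⟩, not_lt.1 hn⟩
    rw [he] at this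
    exact this
  · obtain ⟨p, hp, hmin⟩ := hKc.exists_isMinOn hne continuous_fst.continuousOn
    have hp0 : 0 < p.1 := by
      rcases hp.1.1.1.eq_or_lt with h | h
      · have h2 : x p.1 p.2 ≤ 0 := hp.2
        rw [← h] at h2
        exact absurd h2 (not_le.2 (h0 _ hp.1.2))
      · exact h
    -- `p.1` is the least parameter at which positivity fails somewhere on the segment; it is
    -- positive, and half of it lies below every failure.
    refine ⟨p.1 / 2, by linarith, by linarith [hp.1.1.2], fun l hl t ht => ?_⟩
    by_contra hn
    have : p.1 ≤ l := hmin (a := (l, t))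
      ⟨⟨⟨hl.1, by linarith [hl.2, hp.1.1.2]⟩, ht⟩, not_lt.1 hn⟩
    linarith [hl.2]

end Joint

/-! ### Isometric ribbons and their orientation. -/

section SameRibbon
variable {a b : ℝ}

/-- Two ribbons have the same inner geometry. -/
structure IsoRibbon (a b : ℝ) (c d c' d' : ℝ → E3) : Prop where
  left : ∀ t ∈ Icc a b, ⟪dot a b c' t, dot a b c' t⟫_ℝ = ⟪dot a b c t, dot a b c t⟫_ℝ
  right : ∀ t ∈ Icc a b, ⟪dot a b d' t, dot a b d' t⟫_ℝ = ⟪dot a b d t, dot a b d t⟫_ℝ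
  ruling : ∀ t ∈ Icc a b, ⟪d' t - c' t, d' t - c' t⟫_ℝ = ⟪d t - c t, d t - c t⟫_ℝ
  left_ruling : ∀ t ∈ Icc a b, ⟪dot a b c' t, d' t - c' t⟫_ℝ = ⟪dot a b c t, d t - c t⟫_ℝ
  right_ruling : ∀ t ∈ Icc a b, ⟪dot a b d' t, d' t - c' t⟫_ℝ = ⟪dot a b d t, d t - c t⟫_ℝ
  left_right : ∀ t ∈ Icc a b, ⟪dot a b c' t, dot a b d' t⟫_ℝ = ⟪dot a b c t, dot a b d t⟫_ℝ

/-- Two ribbons have the same inner geometry and the same orientation. -/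
structure SameRibbon (a b : ℝ) (c d c' d' : ℝ → E3) : Prop extends IsoRibbon a b c d c' d' where
  orient : ∀ t ∈ Icc a b, ⟪cross (dot a b c' t) (d' t - c' t), dot a b d' t⟫_ℝ =
    ⟪cross (dot a b c t) (d t - c t), dot a b d t⟫_ℝ

lemma constRibbon_of {I : Type*} {o : I} {c d : ℝ → E3} {c' d' : I → ℝ → E3}
    (h : ∀ i, SameRibbon a b c d (c' i) (d' i)) : ConstRibbon a b o c' d' where
  left i t ht := ((h i).left t ht).trans ((h o).left t ht).symm
  right i t ht := ((h i).right t ht).trans ((h o).right t ht).symm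
  ruling i t ht := ((h i).ruling t ht).trans ((h o).ruling t ht).symm
  left_ruling i t ht := ((h i).left_ruling t ht).trans ((h o).left_ruling t ht).symm
  right_ruling i t ht := ((h i).right_ruling t ht).trans ((h o).right_ruling t ht).symm
  left_right i t ht := ((h i).left_right t ht).trans ((h o).left_right t ht).symm
  orient i t ht := ((h i).orient t ht).trans ((h o).orient t ht).symm

lemma IsoRibbon.det_sq {c d c' d' : ℝ → E3} (h : IsoRibbon a b c d c' d') {t : ℝ}
    (ht : t ∈ Icc a b) : ⟪cross (dot a b c' t) (d' t - c' t), dot a b d' t⟫_ℝ ^ 2 =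
      ⟪cross (dot a b c t) (d t - c t), dot a b d t⟫_ℝ ^ 2 := by
  simp only [Ribbon.det_sq]
  rw [real_inner_comm (dot a b d' t) (d' t - c' t), real_inner_comm (dot a b d t) (d t - c t),
    h.left t ht, h.right t ht, h.ruling t ht, h.left_ruling t ht, h.right_ruling t ht,
    h.left_right t ht]

/-- The orientation of a ribbon cannot change in a continuous isometric deformation. -/
lemma sameRibbon_of_joint {ε : ℝ} {c d : ℝ → ℝ → E3} (hε : 0 < ε) (hab : a < b)
    (hc : JointSmooth a b ε c) (hd : JointSmooth a b ε d)
    (h : ∀ l ∈ Icc 0 ε, IsoRibbon a b (c 0) (d 0) (c l) (d l)) {l : ℝ} (hl : l ∈ Icc 0 ε) :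
    SameRibbon a b (c 0) (d 0) (c l) (d l) :=
  ⟨h l hl, fun _ ht => eq_start_of_sq
    (x := fun l t => ⟪cross (dot a b (c l) t) (d l t - c l t), dot a b (d l) t⟫_ℝ)
    (((hc.dot hε hab).cross (hd.sub hc)).inner (hd.dot hε hab)).continuousOn ht
    (right_mem_Icc.2 hε.le) (fun l hl => (h l hl).det_sq ht) hl⟩

end SameRibbon

/-! ### A constant fold forces the adjacent fold to be constant. -/

section Propagation
variable {a b ε : ℝ} {c₀ c₁ c₂ c₃ : ℝ → ℝ → E3}

lemma continuousOn_bend (h₀ : JointSmooth a b ε c₀) (h₁ : JointSmooth a b ε c₁)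
    (h₂ : JointSmooth a b ε c₂) :
    ContinuousOn (fun p : ℝ × ℝ => bend (c₀ p.1) (c₁ p.1) (c₂ p.1) p.2)
      (Icc 0 ε ×ˢ Icc a b) :=
  ((h₂.sub h₁).inner (h₀.sub h₁)).continuousOn

lemma continuousOn_vdet (hε : 0 < ε) (hab : a < b) (h₀ : JointSmooth a b ε c₀)
    (h₁ : JointSmooth a b ε c₁) (h₂ : JointSmooth a b ε c₂) :
    ContinuousOn (fun p : ℝ × ℝ => vdet a b (c₀ p.1) (c₁ p.1) (c₂ p.1) p.2)
      (Icc 0 ε ×ˢ Icc a b) :=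
  (((h₁.dot hε hab).cross (h₂.sub h₁)).inner (h₀.sub h₁)).continuousOn

lemma continuousOn_adet (hε : 0 < ε) (hab : a < b) (h₀ : JointSmooth a b ε c₀)
    (h₁ : JointSmooth a b ε c₁) :
    ContinuousOn (fun p : ℝ × ℝ => adet a b (c₀ p.1) (c₁ p.1) p.2) (Icc 0 ε ×ˢ Icc a b) :=
  (((h₀.dot hε hab).cross ((h₀.dot hε hab).dot hε hab)).inner (h₁.sub h₀)).continuousOn

/-- If the angle between adjacent ribbons is constant up to the parameter `s`, so is their
determinant. -/
lemma vdet_eq_start (hε : 0 < ε) (hab : a < b) (h₀ : JointSmooth a b ε c₀)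
    (h₁ : JointSmooth a b ε c₁) (h₂ : JointSmooth a b ε c₂)
    (hr₀ : ∀ l ∈ Icc 0 ε, SameRibbon a b (c₁ 0) (c₀ 0) (c₁ l) (c₀ l))
    (hr₁ : ∀ l ∈ Icc 0 ε, SameRibbon a b (c₁ 0) (c₂ 0) (c₁ l) (c₂ l))
    {s t : ℝ} (hs : s ∈ Icc 0 ε) (ht : t ∈ Icc a b)
    (hb : ∀ l ∈ Icc 0 s, bend (c₀ l) (c₁ l) (c₂ l) t = bend (c₀ 0) (c₁ 0) (c₂ 0) t)
    {l : ℝ} (hl : l ∈ Icc 0 s) :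
    vdet a b (c₀ l) (c₁ l) (c₂ l) t = vdet a b (c₀ 0) (c₁ 0) (c₂ 0) t := by
  have hm : ∀ i : Icc 0 s, (i : ℝ) ∈ Icc 0 ε := fun i => ⟨i.2.1, i.2.2.trans hs.2⟩
  refine eq_start_of_sq (x := fun l t => vdet a b (c₀ l) (c₁ l) (c₂ l) t)
    (continuousOn_vdet hε hab h₀ h₁ h₂) ht hs (fun l hl => ?_) hl
  obtain ⟨r, hr⟩ := vdet_sq_mem (I := Icc 0 s) (o := ⟨0, le_rfl, hs.1⟩) (A := Constant)
    (c₀ := fun i => c₀ i) (c₁ := fun i => c₁ i) (c₂ := fun i => c₂ i)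
    ht isFieldlike_constant (constRibbon_of fun i => hr₀ i (hm i))
    (constRibbon_of fun i => hr₁ i (hm i)) ⟨_, fun i => hb i i.2⟩
  exact (hr ⟨l, hl⟩).trans (hr ⟨0, le_rfl, hs.1⟩).symm

/-- In a flexion of three ribbons a constant angle at the first of the middle curves forces a
constant angle at the second one. -/
theorem bend_eq_start (hε : 0 < ε) (hab : a < b) (h₀ : JointSmooth a b ε c₀)
    (h₁ : JointSmooth a b ε c₁) (h₂ : JointSmooth a b ε c₂) (h₃ : JointSmooth a b ε c₃)
    (hr₀ : ∀ l ∈ Icc 0 ε, SameRibbon a b (c₁ 0) (c₀ 0) (c₁ l) (c₀ l))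
    (hr₁ : ∀ l ∈ Icc 0 ε, SameRibbon a b (c₁ 0) (c₂ 0) (c₁ l) (c₂ l))
    (hr₂ : ∀ l ∈ Icc 0 ε, SameRibbon a b (c₂ 0) (c₃ 0) (c₂ l) (c₃ l))
    {s t : ℝ} (hs : s ∈ Icc 0 ε) (ht : t ∈ Icc a b)
    (hdet : vdet a b (c₀ 0) (c₁ 0) (c₂ 0) t ≠ 0)
    (hcross : cross (dot a b (c₂ 0) t) (dot a b (dot a b (c₂ 0)) t) ≠ 0)
    (hb : ∀ l ∈ Icc 0 s, bend (c₀ l) (c₁ l) (c₂ l) t = bend (c₀ 0) (c₁ 0) (c₂ 0) t)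
    {l : ℝ} (hl : l ∈ Icc 0 s) :
    bend (c₁ l) (c₂ l) (c₃ l) t = bend (c₁ 0) (c₂ 0) (c₃ 0) t := by
  have hm : ∀ i : Icc 0 s, (i : ℝ) ∈ Icc 0 ε := fun i => ⟨i.2.1, i.2.2.trans hs.2⟩
  have hv := fun l (hl : l ∈ Icc 0 s) => vdet_eq_start hε hab h₀ h₁ h₂ hr₀ hr₁ hs ht hb hl
  have s₂ : IsSmooth a b fun i : Icc 0 s => c₂ i := fun i => h₂.slice (hm i)
  have s₃ : IsSmooth a b fun i : Icc 0 s => c₃ i := fun i => h₃.slice (hm i)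
  -- The family is indexed by the deformation parameter and the class is the constants, so "known"
  -- means independent of the parameter.
  have hV : VertexKnown (I := Icc 0 s) a b Constant t (fun i => c₀ i) (fun i => c₁ i)
      (fun i => c₂ i) :=
    vertexKnown (o := ⟨0, le_rfl, hs.1⟩) hab ht isFieldlike_constant
      (fun i => h₀.slice (hm i)) (fun i => h₁.slice (hm i)) s₂
      (constRibbon_of fun i => hr₀ i (hm i)) (constRibbon_of fun i => hr₁ i (hm i))
      ⟨_, fun i => hb i i.2⟩ ⟨_, fun i => hv i i.2⟩ fun i => by
        have := hv i i.2
        rw [vdet] at this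
        rw [this]
        exact hdet
  have hr : ConstRuling (I := Icc 0 s) a b ⟨0, le_rfl, hs.1⟩ (fun i => c₂ i) (fun i => c₃ i) :=
    (constRibbon_of fun i : Icc 0 s => hr₂ i (hm i)).constRuling hab s₂ s₃
  have hc : ∀ i : Icc 0 s, cross (dot a b (c₂ i) t) (dot a b (dot a b (c₂ i)) t) ≠ 0 := by
    intro i
    have mc := hV.frame.cross hV.next_dot hV.next_acc
    obtain ⟨r, hr⟩ := hV.frame.inner mc mc
    have := (hr i).trans (hr ⟨0, le_rfl, hs.1⟩).symm
    -- |ċ₂ × c̈₂|² does not depend on the parameter, so it is nonzero because it is nonzero at 0.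
    exact inner_self_ne_zero.1 (this.trans_ne (inner_self_ne_zero.2 hcross))
  have ha : ∀ l ∈ Icc 0 s, adet a b (c₂ l) (c₃ l) t = adet a b (c₂ 0) (c₃ 0) t := by
    intro l hl
    refine eq_start_of_sq (x := fun l t => adet a b (c₂ l) (c₃ l) t)
      (continuousOn_adet hε hab h₂ h₃) ht hs (fun l hl => ?_) hl
    obtain ⟨r, hr⟩ := hV.adet_sq_mem ht hr
    exact (hr ⟨l, hl⟩).trans (hr ⟨0, le_rfl, hs.1⟩).symm
  obtain ⟨r, hr⟩ := hV.bend_mem ht hr ⟨_, fun i => ha i i.2⟩ hc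
  exact (hr ⟨l, hl⟩).trans (hr ⟨0, le_rfl, hs.1⟩).symm

end Propagation
end Ribbon
namespace Ribbon

/-! ### Frames with equal equations of motion differ by a fixed rotation. -/

section Rotation
variable {a b : ℝ}

/-- The vector whose products with `x, y, z` are the given numbers. -/
noncomputable def ofProducts (x y z : E3) (α β γ : ℝ) : E3 :=
  (⟪cross x y, z⟫_ℝ)⁻¹ • (α • cross y z + β • cross z x + γ • cross x y)

lemma inner_ofProducts {x y z : E3} (h : ⟪cross x y, z⟫_ℝ ≠ 0) (α β γ : ℝ) :
    ⟪ofProducts x y z α β γ, x⟫_ℝ = α ∧ ⟪ofProducts x y z α β γ, y⟫_ℝ = β ∧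
      ⟪ofProducts x y z α β γ, z⟫_ℝ = γ := by
  have hx : ⟪cross y z, x⟫_ℝ = ⟪cross x y, z⟫_ℝ := (det_rotate _ _ _).symm
  have hy : ⟪cross z x, y⟫_ℝ = ⟪cross x y, z⟫_ℝ := det_rotate _ _ _
  have e1 : ∀ u w : E3, ⟪cross u w, u⟫_ℝ = 0 := fun u w => by
    rw [real_inner_comm, inner_cross_left]
  have e2 : ∀ u w : E3, ⟪cross u w, w⟫_ℝ = 0 := fun u w => by
    rw [real_inner_comm, inner_cross_right]
  refine ⟨?_, ?_, ?_⟩ <;>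
    simp only [ofProducts, real_inner_smul_left, inner_add_left, e1, e2, hx, hy] <;> field_simp <;>
    ring

/-- Two smooth frames with the same Gram matrix and the same equations of motion differ by a
fixed rotation. -/
theorem exists_rotation {c₀ c₁ c₂ : Bool → ℝ → E3} (hab : a < b)
    (h₁ : IsSmooth a b c₁) (h₂ : IsSmooth a b c₂)
    (hV : ∀ t ∈ Icc a b, VertexKnown a b Constant t c₀ c₁ c₂) :
    ∃ T : E3 ≃ₗᵢ[ℝ] E3, (∀ x y, T (cross x y) = cross (T x) (T y)) ∧
      ∀ t ∈ Icc a b, ∀ y : Bool → E3,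
        InFrame Constant (fun i => dot a b (c₁ i) t) (fun i => c₂ i t - c₁ i t) y →
          T (y false) = y true := by
  have sv := h₁.dot hab
  have sp := h₂.sub h₁
  have sn := sv.cross sp
  set v : Bool → ℝ → E3 := fun i => dot a b (c₁ i) with hv
  set p : Bool → ℝ → E3 := fun i t => c₂ i t - c₁ i t with hp
  set n : Bool → ℝ → E3 := fun i t => cross (v i t) (p i t) with hn
  -- `R t` sends x to the vector with the same products with the frame of index `true` as x has with
  -- the frame of index `false`.
  set R : ℝ → E3 → E3 := fun t x => ofProducts (v true t) (p true t) (n true t)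
    ⟪x, v false t⟫_ℝ ⟪x, p false t⟫_ℝ ⟪x, n false t⟫_ℝ with hR
  have F : ∀ t ∈ Icc a b, IsFrame Constant (fun i => v i t) (fun i => p i t) :=
    fun t ht => (hV t ht).frame
  have hne : ∀ t ∈ Icc a b, ⟪cross (v true t) (p true t), n true t⟫_ℝ ≠ 0 :=
    fun t ht => (F t ht).gram_ne true
  have con : ∀ {x : Bool → ℝ}, Constant x → x true = x false := by
    rintro x ⟨r, hr⟩; rw [hr, hr]
  have hRm : ∀ t ∈ Icc a b, ∀ x, InFrame Constant (fun i => v i t) (fun i => p i t)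
      (fun i => if i then R t x else x) := by
    intro t ht x
    obtain ⟨e1, e2, e3⟩ := inner_ofProducts (hne t ht) ⟪x, v false t⟫_ℝ
      ⟪x, p false t⟫_ℝ ⟪x, n false t⟫_ℝ
    refine ⟨⟨⟪x, v false t⟫_ℝ, ?_⟩, ⟨⟪x, p false t⟫_ℝ, ?_⟩, ⟨⟪x, n false t⟫_ℝ, ?_⟩⟩ <;>
      rintro (_ | _)
    exacts [rfl, e1, rfl, e2, rfl, e3]
  have hRe : ∀ t ∈ Icc a b, ∀ y : Bool → E3,
      InFrame Constant (fun i => v i t) (fun i => p i t) y → R t (y false) = y true := by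
    intro t ht y hy
    obtain ⟨e1, e2, e3⟩ := inner_ofProducts (hne t ht) ⟪y false, v false t⟫_ℝ
      ⟪y false, p false t⟫_ℝ ⟪y false, n false t⟫_ℝ
    exact eq_of_inner_eq (hne t ht) (e1.trans (con hy.left).symm) (e2.trans (con hy.right).symm)
      (e3.trans (con hy.normal).symm)
  have hRs : ∀ x, ContDiffOn ℝ ∞ (fun t => R t x) (Icc a b) := by
    intro x
    refine ContDiffOn.smul (ContDiffOn.inv ((sn true).inner ℝ (sn true)) hne) ?_
    exact ((((contDiffOn_const (c := x)).inner ℝ (sv false)).smul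
      (ContDiffOn.cross (sp true) (sn true))).add
      (((contDiffOn_const (c := x)).inner ℝ (sp false)).smul
        (ContDiffOn.cross (sn true) (sv true)))).add
      (((contDiffOn_const (c := x)).inner ℝ (sn false)).smul
        (ContDiffOn.cross (sv true) (sp true)))
  -- the transfer map is constant in time
  have hstep : ∀ t ∈ Icc a b, ∀ x, ∀ e : Bool → ℝ → E3, IsSmooth a b e →
      (∀ s ∈ Icc a b, InFrame Constant (fun i => v i s) (fun i => p i s) (fun i => e i s)) →
      InFrame Constant (fun i => v i t) (fun i => p i t) (fun i => dot a b (e i) t) →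
      ⟪dot a b (fun t => R t x) t, e true t⟫_ℝ = 0 := by
    intro t ht x e se he hde
    have d1 := hasDerivWithinAt_inner (hRs x) (se true) ht
    have d0 := hasDerivWithinAt_inner (contDiffOn_const (c := x)) (se false) ht
    have heq : ∀ s ∈ Icc a b, ⟪R s x, e true s⟫_ℝ = ⟪x, e false s⟫_ℝ := fun s hs =>
      con ((F s hs).inner (hRm s hs x) (he s hs))
    -- In the derivative of ⟨R x, e true⟩ = ⟨x, e false⟩ the terms with the derivative of e cancel,
    -- since it too has the same coordinates in both frames; only the derivative of R remains.
    have := deriv_unique hab ht heq d1 d0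
    have h2 : ⟪R t x, dot a b (e true) t⟫_ℝ = ⟪x, dot a b (e false) t⟫_ℝ :=
      con ((F t ht).inner (hRm t ht x) hde)
    have h3 : dot a b (fun _ => x) t = 0 := dot_eq hab ht (hasDerivWithinAt_const t _ x)
    rw [h2, h3, inner_zero_left] at this
    linarith
  have hdp : ∀ t ∈ Icc a b, InFrame Constant (fun i => v i t) (fun i => p i t)
      (fun i => dot a b (p i) t) := by
    intro t ht
    have : (fun i => dot a b (p i) t) = fun i => dot a b (c₂ i) t - v i t :=
      funext fun i => dot_sub hab (h₂ i) (h₁ i) ht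
    rw [this]
    exact (F t ht).sub (hV t ht).next_dot (F t ht).mem_left
  have hR0 : ∀ t ∈ Icc a b, ∀ x, dot a b (fun t => R t x) t = 0 := by
    intro t ht x
    have e1 := hstep t ht x v sv (fun s hs => (F s hs).mem_left) (hV t ht).acc
    have e2 := hstep t ht x p sp (fun s hs => (F s hs).mem_right) (hdp t ht)
    have e3 := hstep t ht x n sn (fun s hs => (F s hs).cross (F s hs).mem_left (F s hs).mem_right)
      (by
        simp only [hn, dot_cross hab (sv _) (sp _) ht]
        exact (F t ht).add ((F t ht).cross (hV t ht).acc (F t ht).mem_right)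
          ((F t ht).cross (F t ht).mem_left (hdp t ht)))
    refine eq_of_inner_eq (hne t ht) ?_ ?_ ?_ <;> rw [inner_zero_left] <;> assumption
  have hRc : ∀ t ∈ Icc a b, ∀ x, R t x = R a x := by
    intro t ht x
    exact constant_of_derivWithin_zero (f := fun t => R t x)
      ((hRs x).differentiableOn (by simp)) (fun s hs => hR0 s (Ico_subset_Icc_self hs) x) t ht
  have ha : a ∈ Icc a b := left_mem_Icc.2 hab.le
  let L : E3 →ₗ[ℝ] E3 :=
    { toFun := R a
      map_add' := fun x y => by
        simp only [hR, ofProducts, inner_add_left, add_smul, ← smul_add]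
        congr 1
        abel
      map_smul' := fun r x => by
        simp only [hR, ofProducts, real_inner_smul_left, mul_smul, RingHom.id_apply, ← smul_add]
        rw [smul_comm] }
  have hL : ∀ x y, ⟪L x, L y⟫_ℝ = ⟪x, y⟫_ℝ := fun x y =>
    con ((F a ha).inner (hRm a ha x) (hRm a ha y))
  refine ⟨(L.isometryOfInner hL).toLinearIsometryEquiv rfl, fun x y => ?_, fun t ht y hy => ?_⟩
  · exact hRe a ha (fun i => if i then cross (R a x) (R a y) else cross x y) (by
      convert (F a ha).cross (hRm a ha x) (hRm a ha y) using 2 with i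
      cases i <;> rfl)
  · rw [← hRe t ht y hy, hRc t ht]
    rfl

end Rotation

/-! ### Inner geometry, orientations and folds determine the surface. -/

section Congruence
variable {a b : ℝ}

lemma dot_affine {T : E3 ≃ₗᵢ[ℝ] E3} {τ : E3} {c d : ℝ → E3} (hab : a < b)
    (hc : ContDiffOn ℝ ∞ c (Icc a b)) (h : ∀ t ∈ Icc a b, d t = T (c t) + τ) {t : ℝ}
    (ht : t ∈ Icc a b) : dot a b d t = T (dot a b c t) := by
  refine dot_eq hab ht ?_
  have h1 : HasDerivWithinAt (fun s => T (c s) + τ) (T (dot a b c t)) (Icc a b) t :=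
    ((T.toContinuousLinearEquiv.toContinuousLinearMap.hasFDerivAt.comp_hasDerivWithinAt t
      (hasDerivWithinAt_dot hc ht)).add_const τ)
  exact h1.congr h (h t ht)

/-- A surface is determined up to a motion by its inner geometry, the orientations of its ribbons
and the angles between adjacent ribbons. -/
theorem congruent_of_bend {k m : ℕ} {f g : ℕ → ℝ → E3} (hab : a < b)
    (hf : ∀ i, k ≤ i → i ≤ k + 2 + m → ContDiffOn ℝ ∞ (f i) (Icc a b))
    (hg : ∀ i, k ≤ i → i ≤ k + 2 + m → ContDiffOn ℝ ∞ (g i) (Icc a b))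
    (hr : ∀ i, k ≤ i → i < k + 2 + m → SameRibbon a b (f i) (f (i + 1)) (g i) (g (i + 1)))
    (hdet : ∀ i, k ≤ i → i < k + 1 + m → ∀ t ∈ Icc a b,
      vdet a b (f i) (f (i + 1)) (f (i + 2)) t ≠ 0)
    (hdet' : ∀ i, k ≤ i → i < k + 1 + m → ∀ t ∈ Icc a b,
      vdet a b (g i) (g (i + 1)) (g (i + 2)) t = vdet a b (f i) (f (i + 1)) (f (i + 2)) t)
    (hb : ∀ i, k ≤ i → i < k + 1 + m → ∀ t ∈ Icc a b,
      bend (g i) (g (i + 1)) (g (i + 2)) t = bend (f i) (f (i + 1)) (f (i + 2)) t) :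
    ∃ (T : E3 ≃ₗᵢ[ℝ] E3) (τ : E3), ∀ i, k ≤ i → i ≤ k + 2 + m → ∀ t ∈ Icc a b,
      g i t = T (f i t) + τ := by
  -- The two surfaces are viewed as a family of two members, to which the frame calculus with the
  -- class of constants applies.
  let C : ℕ → Bool → ℝ → E3 := fun i j => if j then g i else f i
  have sC : ∀ i, k ≤ i → i ≤ k + 2 + m → IsSmooth a b (C i) := by
    rintro i h1 h2 (_ | _)
    exacts [hf i h1 h2, hg i h1 h2]
  have rC : ∀ i, k ≤ i → i < k + 2 + m → ConstRibbon a b false (C i) (C (i + 1)) := by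
    intro i h1 h2
    refine constRibbon_of (c := f i) (d := f (i + 1)) ?_
    rintro (_ | _)
    · exact ⟨⟨fun _ _ => rfl, fun _ _ => rfl, fun _ _ => rfl, fun _ _ => rfl, fun _ _ => rfl,
        fun _ _ => rfl⟩, fun _ _ => rfl⟩
    · exact hr i h1 h2
  have hV : ∀ t ∈ Icc a b, VertexKnown a b Constant t (C k) (C (k + 1)) (C (k + 2)) := by
    intro t ht
    refine vertexKnown hab ht isFieldlike_constant (sC k le_rfl (by omega))
      (sC _ (by omega) (by omega)) (sC _ (by omega) (by omega)) (rC k le_rfl (by omega)).symm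
      (rC (k + 1) (by omega) (by omega)) ⟨bend (f k) (f (k + 1)) (f (k + 2)) t, ?_⟩
      ⟨vdet a b (f k) (f (k + 1)) (f (k + 2)) t, ?_⟩ ?_
    · rintro (_ | _)
      exacts [rfl, hb k le_rfl (by omega) t ht]
    · rintro (_ | _)
      exacts [rfl, hdet' k le_rfl (by omega) t ht]
    · rintro (_ | _)
      · exact hdet k le_rfl (by omega) t ht
      · have := hdet k le_rfl (by omega) t ht
        rwa [← hdet' k le_rfl (by omega) t ht] at this
  obtain ⟨T, hT, hTe⟩ := exists_rotation hab (sC _ (by omega) (by omega))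
    (sC _ (by omega) (by omega)) hV
  have hv : ∀ t ∈ Icc a b, T (dot a b (f (k + 1)) t) = dot a b (g (k + 1)) t := fun t ht =>
    hTe t ht _ (hV t ht).frame.mem_left
  have hp : ∀ t ∈ Icc a b, T (f (k + 2) t - f (k + 1) t) = g (k + 2) t - g (k + 1) t :=
    fun t ht => hTe t ht _ (hV t ht).frame.mem_right
  have hq : ∀ t ∈ Icc a b, T (f k t - f (k + 1) t) = g k t - g (k + 1) t :=
    fun t ht => hTe t ht _ (hV t ht).prev
  have sf1 := hf (k + 1) (by omega) (by omega)
  have sg1 := hg (k + 1) (by omega) (by omega)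
  -- The velocities correspond under T, so integration along one curve produces the translation.
  have h1 : ∀ t ∈ Icc a b, g (k + 1) t = T (f (k + 1) t) + (g (k + 1) a - T (f (k + 1) a)) := by
    have hd : ∀ t ∈ Icc a b, HasDerivWithinAt (fun t => g (k + 1) t - T (f (k + 1) t)) 0
        (Icc a b) t := by
      intro t ht
      have := (hasDerivWithinAt_dot sg1 ht).sub
        (T.toContinuousLinearEquiv.toContinuousLinearMap.hasFDerivAt.comp_hasDerivWithinAt t
          (hasDerivWithinAt_dot sf1 ht))
      exact this.congr_deriv (sub_eq_zero.2 (hv t ht).symm)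
    intro t ht
    have := constant_of_derivWithin_zero (fun t ht => (hd t ht).differentiableWithinAt)
      (fun s hs => (hd s (Ico_subset_Icc_self hs)).derivWithin
        (uniqueDiffOn_Icc hab s (Ico_subset_Icc_self hs))) t ht
    rw [← this]
    abel
  set τ := g (k + 1) a - T (f (k + 1) a) with hτ
  have h0 : ∀ t ∈ Icc a b, g k t = T (f k t) + τ := by
    intro t ht
    rw [← sub_add_cancel (g k t) (g (k + 1) t), ← hq t ht, h1 t ht, map_sub]
    abel
  have h2 : ∀ t ∈ Icc a b, g (k + 2) t = T (f (k + 2) t) + τ := by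
    intro t ht
    rw [← sub_add_cancel (g (k + 2) t) (g (k + 1) t), ← hp t ht, h1 t ht, map_sub]
    abel
  have main : ∀ j, j ≤ m + 1 → (∀ t ∈ Icc a b, g (k + j) t = T (f (k + j) t) + τ) ∧
      ∀ t ∈ Icc a b, g (k + j + 1) t = T (f (k + j + 1) t) + τ := by
    intro j
    induction j with
    | zero => exact fun _ => ⟨h0, h1⟩
    | succ j ih =>
      intro hj
      obtain ⟨ih0, ih1⟩ := ih (by omega)
      refine ⟨ih1, ?_⟩
      intro t ht
      set i := k + j with hi
      have hd := dot_affine hab (hf (i + 1) (by omega) (by omega)) ih1 ht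
      have hne := hdet i (by omega) (by omega) t ht
      have hq' : g i t - g (i + 1) t = T (f i t - f (i + 1) t) := by
        rw [ih0 t ht, ih1 t ht, map_sub]; abel
      have hne' := hne
      rw [← hdet' i (by omega) (by omega) t ht, vdet_comm, neg_ne_zero, vdet] at hne'
      have key : T (f (i + 2) t - f (i + 1) t) = g (i + 2) t - g (i + 1) t := by
        -- The next ruling is compared with T of the old one on the basis formed by the velocity,
        -- the previous ruling and their cross product. The three products are inner geometry,
        -- `bend` and `vdet`; the last one needs T to respect cross products.
        refine eq_of_inner_eq (x := dot a b (g (i + 1)) t) (y := g i t - g (i + 1) t)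
          (z := cross (dot a b (g (i + 1)) t) (g i t - g (i + 1) t))
          (inner_self_ne_zero.2 fun h => hne' (by rw [h, inner_zero_left])) ?_ ?_ ?_
        · rw [hd, T.inner_map_map, ← hd, real_inner_comm, real_inner_comm (dot a b _ t)]
          exact ((hr (i + 1) (by omega) (by omega)).left_ruling t ht).symm
        · rw [hq', T.inner_map_map, ← hq']
          exact (hb i (by omega) (by omega) t ht).symm
        · rw [hd, hq', ← hT, T.inner_map_map, hT, ← hd, ← hq', real_inner_comm,
            real_inner_comm (cross _ _)]
          have := hdet' i (by omega) (by omega) t ht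
          rw [vdet_comm, vdet_comm _ _ (f i), neg_inj] at this
          exact this.symm
      have e : g (i + 2) t = T (f (i + 2) t - f (i + 1) t) + g (i + 1) t := by rw [key]; abel
      calc g (i + 2) t = T (f (i + 2) t - f (i + 1) t) + g (i + 1) t := e
        _ = T (f (i + 2) t) + τ := by rw [map_sub, ih1 t ht]; abel
  refine ⟨T, τ, fun i h3 h4 => ?_⟩
  obtain ⟨j, rfl⟩ := Nat.exists_eq_add_of_le h3
  rcases (by omega : j ≤ m + 1 ∨ j = m + 1 + 1) with h | rfl
  · exact (main j h).1
  · exact (main (m + 1) le_rfl).2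

end Congruence
end Ribbon
namespace Ribbon

/-! ### Independence of values off the segment. -/

section Congr
variable {a b : ℝ}

lemma IsoRibbon.congr {c d c' d' e f : ℝ → E3} (h : IsoRibbon a b c d c' d')
    (hc : ∀ t ∈ Icc a b, e t = c t) (hd : ∀ t ∈ Icc a b, f t = d t) :
    IsoRibbon a b e f c' d' := by
  have h1 : ∀ t ∈ Icc a b, dot a b e t = dot a b c t := fun t ht => dot_congr hc ht
  have h2 : ∀ t ∈ Icc a b, dot a b f t = dot a b d t := fun t ht => dot_congr hd ht
  constructor <;> intro t ht <;> simp only [h1 t ht, h2 t ht, hc t ht, hd t ht]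
  exacts [h.left t ht, h.right t ht, h.ruling t ht, h.left_ruling t ht, h.right_ruling t ht,
    h.left_right t ht]

lemma SameRibbon.congr {c d c' d' e f : ℝ → E3} (h : SameRibbon a b c d c' d')
    (hc : ∀ t ∈ Icc a b, e t = c t) (hd : ∀ t ∈ Icc a b, f t = d t) :
    SameRibbon a b e f c' d' := by
  refine ⟨h.toIsoRibbon.congr hc hd, fun t ht => ?_⟩
  rw [dot_congr hc ht, dot_congr hd ht, hc t ht, hd t ht, h.orient t ht]

lemma SameRibbon.symm {c d c' d' : ℝ → E3} (h : SameRibbon a b c d c' d') :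
    SameRibbon a b d c d' c' where
  left := h.right
  right := h.left
  ruling t ht := by
    have := h.ruling t ht
    rwa [← neg_sub, inner_neg_neg, ← neg_sub (d t), inner_neg_neg]
  left_ruling t ht := by
    have := h.right_ruling t ht
    rw [← neg_sub, inner_neg_right, this, ← inner_neg_right, neg_sub]
  right_ruling t ht := by
    have := h.left_ruling t ht
    rw [← neg_sub, inner_neg_right, this, ← inner_neg_right, neg_sub]
  left_right t ht := by
    rw [real_inner_comm, h.left_right t ht, real_inner_comm]
  orient t ht := by
    have e : ∀ x y z w : E3, ⟪cross x (y - z), w⟫_ℝ = ⟪cross w (z - y), x⟫_ℝ := by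
      intro x y z w
      simp only [inner_coord, cross_zero_coord, cross_one_coord, cross_two_coord, PiLp.sub_apply]
      ring
    rw [e, h.orient t ht, e]

lemma bend_congr {c₀ c₁ c₂ d₀ d₁ d₂ : ℝ → E3} {t : ℝ} (h₀ : c₀ t = d₀ t) (h₁ : c₁ t = d₁ t)
    (h₂ : c₂ t = d₂ t) : bend c₀ c₁ c₂ t = bend d₀ d₁ d₂ t := by
  rw [bend, bend, h₀, h₁, h₂]

lemma vdet_congr {c₀ c₁ c₂ d₀ d₁ d₂ : ℝ → E3} (h₀ : ∀ t ∈ Icc a b, c₀ t = d₀ t)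
    (h₁ : ∀ t ∈ Icc a b, c₁ t = d₁ t) (h₂ : ∀ t ∈ Icc a b, c₂ t = d₂ t) {t : ℝ}
    (ht : t ∈ Icc a b) : vdet a b c₀ c₁ c₂ t = vdet a b d₀ d₁ d₂ t := by
  rw [vdet, vdet, dot_congr h₁ ht, h₀ t ht, h₁ t ht, h₂ t ht]

lemma dot_dot_congr {c d : ℝ → E3} (h : ∀ s ∈ Icc a b, c s = d s) {t : ℝ} (ht : t ∈ Icc a b) :
    dot a b (dot a b c) t = dot a b (dot a b d) t :=
  dot_congr (fun _ hs => dot_congr h hs) ht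

lemma adet_congr {c₀ c₁ d₀ d₁ : ℝ → E3} (h₀ : ∀ t ∈ Icc a b, c₀ t = d₀ t)
    (h₁ : ∀ t ∈ Icc a b, c₁ t = d₁ t) {t : ℝ} (ht : t ∈ Icc a b) :
    adet a b c₀ c₁ t = adet a b d₀ d₁ t := by
  rw [adet, adet, dot_congr h₀ ht, dot_dot_congr h₀ ht, h₀ t ht, h₁ t ht]

end Congr

/-! ### Flexions of chains of curves. -/

/-- The genericity assumptions on the curves `F 0, …, F n`. -/
structure Generic (a b : ℝ) (n : ℕ) (F : ℕ → ℝ → E3) : Prop where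
  lt : a < b
  smooth : ∀ i ≤ n, ContDiffOn ℝ ∞ (F i) (Icc a b)
  vdet_ne : ∀ i, i + 2 ≤ n → ∀ t ∈ Icc a b, vdet a b (F i) (F (i + 1)) (F (i + 2)) t ≠ 0
  adet_ne : ∀ i, i + 2 ≤ n → ∀ t ∈ Icc a b, adet a b (F (i + 1)) (F (i + 2)) t ≠ 0

/-- `γ` is a flexion, with parameter in `[0,ε]`, of the curves `F k, …, F m`. -/
structure Flexes (a b ε : ℝ) (k m : ℕ) (F : ℕ → ℝ → E3) (γ : ℝ → ℕ → ℝ → E3) : Prop where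
  pos : 0 < ε
  smooth : ∀ i, k ≤ i → i ≤ m → JointSmooth a b ε fun l => γ l i
  start : ∀ i, k ≤ i → i ≤ m → ∀ t ∈ Icc a b, γ 0 i t = F i t
  iso : ∀ i, k ≤ i → i < m → ∀ l ∈ Icc 0 ε,
    IsoRibbon a b (F i) (F (i + 1)) (γ l i) (γ l (i + 1))

/-- The product of the rulings at the curve `F (i + 1)`. -/
noncomputable abbrev bendAt (F : ℕ → ℝ → E3) (i : ℕ) : ℝ → ℝ := bend (F i) (F (i + 1)) (F (i + 2))

namespace Flexes
variable {a b ε : ℝ} {k m n : ℕ} {F : ℕ → ℝ → E3} {γ : ℝ → ℕ → ℝ → E3}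

lemma mono (h : Flexes a b ε k m F γ) {δ : ℝ} (hδ : 0 < δ) (hε : δ ≤ ε) :
    Flexes a b δ k m F γ :=
  ⟨hδ, fun i h1 h2 => (h.smooth i h1 h2).mono hε, h.start,
    fun i h1 h2 l hl => h.iso i h1 h2 l ⟨hl.1, hl.2.trans hε⟩⟩

lemma restrict (h : Flexes a b ε k m F γ) {k' m' : ℕ} (hk : k ≤ k') (hm : m' ≤ m) :
    Flexes a b ε k' m' F γ :=
  ⟨h.pos, fun i h1 h2 => h.smooth i (hk.trans h1) (h2.trans hm),
    fun i h1 h2 => h.start i (hk.trans h1) (h2.trans hm),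
    fun i h1 h2 => h.iso i (hk.trans h1) (h2.trans_le hm)⟩

lemma same_start (h : Flexes a b ε k m F γ) (hab : a < b) {i : ℕ} (hk : k ≤ i) (hm : i < m) {l : ℝ}
    (hl : l ∈ Icc 0 ε) : SameRibbon a b (γ 0 i) (γ 0 (i + 1)) (γ l i) (γ l (i + 1)) :=
  sameRibbon_of_joint h.pos hab (h.smooth i hk hm.le) (h.smooth (i + 1) (by omega) hm)
    (fun l hl => (h.iso i hk hm l hl).congr (h.start i hk hm.le) (h.start (i + 1) (by omega) hm)) hl

lemma same (h : Flexes a b ε k m F γ) (hab : a < b) {i : ℕ} (hk : k ≤ i) (hm : i < m) {l : ℝ}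
    (hl : l ∈ Icc 0 ε) : SameRibbon a b (F i) (F (i + 1)) (γ l i) (γ l (i + 1)) :=
  (h.same_start hab hk hm hl).congr (fun t ht => (h.start i hk hm.le t ht).symm)
    fun t ht => (h.start (i + 1) (by omega) hm t ht).symm

lemma bendAt_start (h : Flexes a b ε k m F γ) {i : ℕ} (hk : k ≤ i) (hm : i + 2 ≤ m) {t : ℝ}
    (ht : t ∈ Icc a b) : bendAt (γ 0) i t = bendAt F i t :=
  bend_congr (h.start i hk (by omega) t ht) (h.start _ (by omega) (by omega) t ht)
    (h.start _ (by omega) (by omega) t ht)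

lemma vdet_start (h : Flexes a b ε k m F γ) {i : ℕ} (hk : k ≤ i) (hm : i + 2 ≤ m) {t : ℝ}
    (ht : t ∈ Icc a b) : vdet a b (γ 0 i) (γ 0 (i + 1)) (γ 0 (i + 2)) t =
      vdet a b (F i) (F (i + 1)) (F (i + 2)) t :=
  vdet_congr (h.start i hk (by omega)) (h.start _ (by omega) (by omega))
    (h.start _ (by omega) (by omega)) ht

lemma adet_start (h : Flexes a b ε k m F γ) {i : ℕ} (hk : k ≤ i) (hm : i + 1 ≤ m) {t : ℝ}
    (ht : t ∈ Icc a b) : adet a b (γ 0 i) (γ 0 (i + 1)) t = adet a b (F i) (F (i + 1)) t :=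
  adet_congr (h.start i hk (by omega)) (h.start _ (by omega) (by omega)) ht

lemma cross_start_ne (h : Flexes a b ε k m F γ) (hF : Generic a b n F) (hmn : m ≤ n) {i : ℕ}
    (hk : k ≤ i + 1) (hm : i + 2 ≤ m) {t : ℝ} (ht : t ∈ Icc a b) :
    cross (dot a b (γ 0 (i + 1)) t) (dot a b (dot a b (γ 0 (i + 1))) t) ≠ 0 := by
  intro h0
  refine hF.adet_ne i (by omega) t ht ?_
  rw [← h.adet_start (i := i + 1) hk hm ht, adet, h0, inner_zero_left]

/-- The angle between adjacent ribbons does not change up to the parameter `s`. -/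
def Still (a b : ℝ) (F : ℕ → ℝ → E3) (γ : ℝ → ℕ → ℝ → E3) (s : ℝ) (i : ℕ) : Prop :=
  ∀ l ∈ Icc 0 s, ∀ t ∈ Icc a b, bendAt (γ l) i t = bendAt F i t

lemma still_succ (h : Flexes a b ε k m F γ) (hF : Generic a b n F) (hmn : m ≤ n) {s : ℝ}
    (hs : s ∈ Icc 0 ε) {i : ℕ} (hk : k ≤ i) (hm : i + 3 ≤ m) (hi : Still a b F γ s i) :
    Still a b F γ s (i + 1) := by
  intro l hl t ht
  rw [← h.bendAt_start (by omega) (by omega) ht]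
  refine bend_eq_start h.pos hF.lt (h.smooth i hk (by omega)) (h.smooth (i + 1) (by omega) (by omega))
    (h.smooth (i + 2) (by omega) (by omega)) (h.smooth (i + 3) (by omega) (by omega))
    (fun l hl => (h.same_start hF.lt hk (by omega) hl).symm)
    (fun l hl => h.same_start hF.lt (by omega) (by omega) hl)
    (fun l hl => h.same_start hF.lt (by omega) (by omega) hl) hs ht ?_ ?_ ?_ hl
  · rw [h.vdet_start hk (by omega) ht]
    exact hF.vdet_ne i (by omega) t ht
  · exact h.cross_start_ne hF hmn (by omega) hm ht
  · intro l hl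
    exact (hi l hl t ht).trans (h.bendAt_start hk (by omega) ht).symm

/-- The same propagation with the order of the four curves reversed. It needs only that the velocity
and acceleration at the new middle curve are independent, so condition 2, stated for the ruling to
the next curve, serves in both directions. -/
lemma still_pred (h : Flexes a b ε k m F γ) (hF : Generic a b n F) (hmn : m ≤ n) {s : ℝ}
    (hs : s ∈ Icc 0 ε) {i : ℕ} (hk : k ≤ i) (hm : i + 3 ≤ m) (hi : Still a b F γ s (i + 1)) :
    Still a b F γ s i := by
  intro l hl t ht
  rw [← h.bendAt_start (by omega) (by omega) ht, bendAt, bendAt, bend_comm, bend_comm (γ 0 i)]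
  refine bend_eq_start h.pos hF.lt (h.smooth (i + 3) (by omega) (by omega))
    (h.smooth (i + 2) (by omega) (by omega)) (h.smooth (i + 1) (by omega) (by omega))
    (h.smooth i hk (by omega))
    (fun l hl => h.same_start hF.lt (i := i + 2) (by omega) (by omega) hl)
    (fun l hl => (h.same_start hF.lt (i := i + 1) (by omega) (by omega) hl).symm)
    (fun l hl => (h.same_start hF.lt hk (by omega) hl).symm) hs ht ?_ ?_ ?_ hl
  · rw [vdet_comm, neg_ne_zero]
    have := h.vdet_start (i := i + 1) (by omega) (by omega) ht
    exact this.trans_ne (hF.vdet_ne (i + 1) (by omega) t ht)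
  · exact h.cross_start_ne hF hmn (by omega) (by omega) ht
  · intro l hl
    rw [bend_comm, bend_comm (γ 0 (i + 3))]
    exact (hi l hl t ht).trans (h.bendAt_start (by omega) (by omega) ht).symm

/-- If one angle is constant in a flexion, all angles are. -/
theorem still_all (h : Flexes a b ε k m F γ) (hF : Generic a b n F) (hmn : m ≤ n) {s : ℝ}
    (hs : s ∈ Icc 0 ε) {j : ℕ} (hkj : k ≤ j) (hjm : j + 2 ≤ m) (hj : Still a b F γ s j) {i : ℕ}
    (hki : k ≤ i) (him : i + 2 ≤ m) : Still a b F γ s i := by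
  rcases le_total j i with hji | hij
  · induction i, hji using Nat.le_induction with
    | base => exact hj
    | succ i hi ih => exact h.still_succ hF hmn hs (by omega) (by omega) (ih (by omega) (by omega))
  · obtain ⟨d, rfl⟩ := Nat.exists_eq_add_of_le hij
    induction d generalizing i with
    | zero => exact hj
    | succ d ih =>
      have e : i + (d + 1) = i + 1 + d := by omega
      rw [e] at hj
      exact h.still_pred hF hmn hs hki (by omega)
        (ih (by omega) (by omega) (by omega) (by omega) hj (by omega))

/-- A flexion with constant angles is a motion. -/
theorem exists_motion (h : Flexes a b ε k m F γ) (hF : Generic a b n F) (hmn : m ≤ n) {s : ℝ}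
    (hs : s ∈ Icc 0 ε) {j : ℕ} (hkj : k ≤ j) (hjm : j + 2 ≤ m) (hj : Still a b F γ s j) :
    ∃ (T : E3 ≃ₗᵢ[ℝ] E3) (τ : E3), ∀ i, k ≤ i → i ≤ m → ∀ t ∈ Icc a b,
      γ s i t = T (F i t) + τ := by
  obtain ⟨m, rfl⟩ := Nat.exists_eq_add_of_le (show k + 2 ≤ m by omega)
  have hss : s ∈ Icc 0 s := ⟨hs.1, le_rfl⟩
  have hall := fun i (h1 : k ≤ i) (h2 : i < k + 1 + m) =>
    h.still_all hF hmn hs hkj hjm hj (i := i) h1 (by omega)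
  refine congruent_of_bend hF.lt (fun i h1 h2 => hF.smooth i (by omega))
    (fun i h1 h2 => (h.smooth i h1 h2).slice hs) (fun i h1 h2 => h.same hF.lt h1 h2 hs)
    (fun i h1 h2 t ht => hF.vdet_ne i (by omega) t ht) (fun i h1 h2 t ht => ?_)
    (fun i h1 h2 t ht => hall i h1 h2 s hss t ht)
  rw [← h.vdet_start (i := i) (by omega) (by omega) ht]
  exact vdet_eq_start (c₀ := fun l => γ l i) (c₁ := fun l => γ l (i + 1))
    (c₂ := fun l => γ l (i + 2)) h.pos hF.lt (h.smooth i h1 (by omega))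
    (h.smooth (i + 1) (by omega) (by omega))
    (h.smooth (i + 2) (by omega) (by omega))
    (fun l hl => (h.same_start hF.lt h1 (by omega) hl).symm)
    (fun l hl => h.same_start hF.lt (by omega) (by omega) hl) hs ht
    (fun l hl => (hall i h1 h2 l hl t ht).trans (h.bendAt_start (by omega) (by omega) ht).symm) hss

/-- The angle at the curve `F (i + 1)` changes immediately. -/
def Moving (a b ε : ℝ) (F : ℕ → ℝ → E3) (γ : ℝ → ℕ → ℝ → E3) (i : ℕ) : Prop :=
  ∀ δ, 0 < δ → ∃ l ∈ Icc 0 ε, l ≤ δ ∧ ∃ t ∈ Icc a b, bendAt (γ l) i t ≠ bendAt F i t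

lemma _root_.Ribbon.isoRibbon_motion {c d c' d' c'' d'' : ℝ → E3} {T : E3 ≃ₗᵢ[ℝ] E3} {τ : E3}
    (hab : a < b) (h : IsoRibbon a b c d c' d') (hc : ContDiffOn ℝ ∞ c' (Icc a b))
    (hd : ContDiffOn ℝ ∞ d' (Icc a b)) (hc' : ∀ t ∈ Icc a b, c'' t = T (c' t) + τ)
    (hd' : ∀ t ∈ Icc a b, d'' t = T (d' t) + τ) : IsoRibbon a b c d c'' d'' := by
  have h1 := fun t (ht : t ∈ Icc a b) => dot_affine hab hc hc' ht
  have h2 := fun t (ht : t ∈ Icc a b) => dot_affine hab hd hd' ht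
  have h3 : ∀ t ∈ Icc a b, d'' t - c'' t = T (d' t - c' t) := fun t ht => by
    rw [hc' t ht, hd' t ht, map_sub]; abel
  constructor <;> intro t ht <;> simp only [h1 t ht, h2 t ht, h3 t ht, T.inner_map_map]
  exacts [h.left t ht, h.right t ht, h.ruling t ht, h.left_ruling t ht, h.right_ruling t ht,
    h.left_right t ht]

lemma _root_.Ribbon.bend_motion {c₀ c₁ c₂ d₀ d₁ d₂ : ℝ → E3} {T : E3 ≃ₗᵢ[ℝ] E3} {τ : E3} {t : ℝ}
    (h₀ : d₀ t = T (c₀ t) + τ) (h₁ : d₁ t = T (c₁ t) + τ) (h₂ : d₂ t = T (c₂ t) + τ) :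
    bend d₀ d₁ d₂ t = bend c₀ c₁ c₂ t := by
  rw [bend, bend, h₀, h₁, h₂, add_sub_add_right_eq_sub, add_sub_add_right_eq_sub, ← map_sub,
    ← map_sub, T.inner_map_map]

/-- A nontrivial flexion can be replaced by one that moves immediately. -/
theorem exists_moving (h : Flexes a b ε k m F γ) (hF : Generic a b n F) (hmn : m ≤ n) {j : ℕ}
    (hkj : k ≤ j) (hjm : j + 2 ≤ m)
    (hne : ∃ l ∈ Icc 0 ε, ∃ t ∈ Icc a b, bendAt (γ l) j t ≠ bendAt F j t) :
    ∃ (δ : ℝ) (γ' : ℝ → ℕ → ℝ → E3), Flexes a b δ k m F γ' ∧ Moving a b δ F γ' j := by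
  -- Up to the infimum s of the parameters at which the angle has changed, the flexion is a motion;
  -- it is restarted at s with that motion undone.
  set S : Set ℝ := {l | l ∈ Icc 0 ε ∧ ∃ t ∈ Icc a b, bendAt (γ l) j t ≠ bendAt F j t} with hS
  have hSne : S.Nonempty := let ⟨l, hl, h⟩ := hne; ⟨l, hl, h⟩
  have hSb : BddBelow S := ⟨0, fun l hl => hl.1.1⟩
  obtain ⟨s, hsdef⟩ : ∃ s, s = sInf S := ⟨_, rfl⟩
  have hs0 : 0 ≤ s := hsdef ▸ le_csInf hSne fun l hl => hl.1.1
  have hsle : ∀ l ∈ S, s ≤ l := fun l hl => hsdef ▸ csInf_le hSb hl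
  have hsε : s ≤ ε := let ⟨l, hl⟩ := hSne; (hsle l hl).trans hl.1.2
  have hlt : ∀ l, 0 ≤ l → l < s → ∀ t ∈ Icc a b, bendAt (γ l) j t = bendAt F j t := by
    intro l hl0 hl t ht
    by_contra hn
    exact absurd (hsle l ⟨⟨hl0, hl.le.trans hsε⟩, t, ht, hn⟩) (not_le.2 hl)
  have hat : ∀ t ∈ Icc a b, bendAt (γ s) j t = bendAt F j t := by
    intro t ht
    rcases hs0.eq_or_lt with h0 | h0
    · rw [← h0]
      exact h.bendAt_start hkj hjm ht
    · have hb : ContinuousOn (fun p : ℝ × ℝ => bend (γ p.1 j) (γ p.1 (j + 1)) (γ p.1 (j + 2)) p.2)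
          (Icc 0 ε ×ˢ Icc a b) :=
        continuousOn_bend (c₀ := fun l => γ l j) (c₁ := fun l => γ l (j + 1))
          (c₂ := fun l => γ l (j + 2)) (h.smooth j hkj (by omega))
          (h.smooth (j + 1) (by omega) (by omega)) (h.smooth (j + 2) (by omega) (by omega))
      have hcont : ContinuousOn (fun l => bendAt (γ l) j t) (Icc 0 s) :=
        continuousOn_param (x := fun l t => bendAt (γ l) j t) hb ht hsε
      have hcl : closure (Ico 0 s) = Icc 0 s := closure_Ico h0.ne
      have : EqOn (fun l => bendAt (γ l) j t) (fun _ => bendAt F j t) (Icc 0 s) :=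
        Set.EqOn.of_subset_closure (s := Ico 0 s) (fun l hl => hlt l hl.1 hl.2 t ht) hcont
          continuousOn_const Ico_subset_Icc_self hcl.ge
      exact this (right_mem_Icc.2 hs0)
  have hstill : Still a b F γ s j := by
    intro l hl t ht
    rcases hl.2.eq_or_lt with rfl | h1
    · exact hat t ht
    · exact hlt l hl.1 h1 t ht
  have hsS : s ∉ S := fun hs => let ⟨t, ht, hn⟩ := hs.2; hn (hat t ht)
  have hsε' : s < ε := by
    refine hsε.lt_of_ne fun he => ?_
    obtain ⟨l, hl⟩ := hSne
    have : l = s := le_antisymm (he ▸ hl.1.2) (hsle l hl)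
    exact hsS (this ▸ hl)
  obtain ⟨T, τ, hT⟩ := h.exists_motion hF hmn ⟨hs0, hsε⟩ hkj hjm hstill
  have hmem : ∀ l ∈ Icc 0 (ε - s), s + l ∈ Icc 0 ε := fun l hl =>
    ⟨add_nonneg hs0 hl.1, by linarith [hl.2]⟩
  -- The witness applies x ↦ T⁻¹(x - τ), the inverse of the motion reached at s, to γ(s + l).
  refine ⟨ε - s, fun l i t => T.symm (γ (s + l) i t) + -T.symm τ, ⟨by linarith, ?_, ?_, ?_⟩, ?_⟩
  · intro i h1 h2
    have h3 : ContDiffOn ℝ ∞ (fun p : ℝ × ℝ => γ (s + p.1) i p.2)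
        (Icc 0 (ε - s) ×ˢ Icc a b) :=
      ContDiffOn.comp (g := fun p : ℝ × ℝ => γ p.1 i p.2) (f := fun p : ℝ × ℝ => (s + p.1, p.2))
        (h.smooth i h1 h2)
        ((contDiff_const.add contDiff_fst).prodMk contDiff_snd).contDiffOn
        fun p hp => ⟨hmem _ hp.1, hp.2⟩
    exact (T.symm.contDiff.comp_contDiffOn h3).add contDiffOn_const
  · intro i h1 h2 t ht
    simp only [add_zero, hT i h1 h2 t ht, map_add, T.symm_apply_apply]
    abel
  · intro i h1 h2 l hl
    exact isoRibbon_motion hF.lt (h.iso i h1 h2 (s + l) (hmem l hl))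
      ((h.smooth i h1 h2.le).slice (hmem l hl))
      ((h.smooth (i + 1) (by omega) h2).slice (hmem l hl)) (fun t ht => rfl) (fun t ht => rfl)
  · intro δ hδ
    obtain ⟨l, hl, hlδ⟩ := exists_lt_of_csInf_lt hSne (show sInf S < s + δ by linarith)
    have hsl : s ≤ l := hsle l hl
    refine ⟨l - s, ⟨by linarith, by linarith [hl.1.2]⟩, by linarith, ?_⟩
    obtain ⟨t, ht, hn⟩ := hl.2
    refine ⟨t, ht, ?_⟩
    have e : s + (l - s) = l := by ring
    refine (bend_motion (T := T.symm) (τ := -T.symm τ) (c₀ := γ l j) (c₁ := γ l (j + 1))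
      (c₂ := γ l (j + 2)) ?_ ?_ ?_).trans_ne hn <;> simp only [e]

end Flexes
end Ribbon
namespace Ribbon

/-! ### An angle that agrees at one time agrees at all times. -/

section Uniqueness
variable {a b : ℝ}

/-- Grönwall's inequality, with K a bound for the coefficient on the compact segment. -/
lemma eq_zero_right_of_linear_ode {d c : ℝ → ℝ} {r : ℝ} (hr : r ∈ Icc a b)
    (hc : ContinuousOn c (Icc a b))
    (hd : ∀ t ∈ Icc a b, HasDerivWithinAt d (c t * d t) (Icc a b) t) (h0 : d r = 0) :
    ∀ t ∈ Icc r b, d t = 0 := by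
  obtain ⟨K, hK⟩ := isCompact_Icc.exists_bound_of_continuousOn hc
  have hsub : Icc r b ⊆ Icc a b := Icc_subset_Icc_left hr.1
  refine eq_zero_of_abs_deriv_le_mul_abs_self_of_eq_zero_right (K := K)
    (fun t ht => ((hd t (hsub ht)).continuousWithinAt).mono hsub) (f' := fun t => c t * d t)
    (fun t ht => ?_) h0 (fun t ht => ?_)
  · exact ((hd t (hsub (Ico_subset_Icc_self ht))).mono hsub).mono_of_mem_nhdsWithin
      (Icc_mem_nhdsGE_of_mem ht)
  · rw [norm_mul]
    exact mul_le_mul_of_nonneg_right (hK t (hsub (Ico_subset_Icc_self ht))) (norm_nonneg _)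

lemma eq_zero_of_linear_ode {d c : ℝ → ℝ} {r : ℝ} (hr : r ∈ Icc a b)
    (hc : ContinuousOn c (Icc a b))
    (hd : ∀ t ∈ Icc a b, HasDerivWithinAt d (c t * d t) (Icc a b) t) (h0 : d r = 0) :
    ∀ t ∈ Icc a b, d t = 0 := by
  intro t ht
  rcases le_total r t with h | h
  · exact eq_zero_right_of_linear_ode hr hc hd h0 t ⟨h, ht.2⟩
  -- To the left of r, reverse time.
  · have hm : MapsTo (fun s : ℝ => -s) (Icc (-b) (-a)) (Icc a b) := fun s hs =>
      ⟨le_neg.2 hs.2, neg_le.2 hs.1⟩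
    have := eq_zero_right_of_linear_ode (a := -b) (b := -a) (r := -r) (d := fun s => d (-s))
      (c := fun s => -c (-s)) ⟨neg_le_neg hr.2, neg_le_neg hr.1⟩
      (hc.comp continuous_neg.continuousOn hm).neg (fun s hs => ?_) (by simpa using h0) (-t)
      ⟨neg_le_neg h, neg_le_neg ht.1⟩
    · simpa using this
    · have := (hd (-s) (hm hs)).scomp s ((hasDerivWithinAt_id s (Icc (-b) (-a))).neg) hm
      refine this.congr_deriv ?_
      simp only [smul_eq_mul]
      ring

/-- The products of a vector with known products with `v, p, v × p`. -/
lemma inner_eq_of_frame {v p y z : E3} (h : cross v p ≠ 0) : ⟪y, z⟫_ℝ =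
    ((⟪p, p⟫_ℝ * ⟪y, v⟫_ℝ - ⟪v, p⟫_ℝ * ⟪y, p⟫_ℝ) * ⟪z, v⟫_ℝ +
      (⟪v, v⟫_ℝ * ⟪y, p⟫_ℝ - ⟪v, p⟫_ℝ * ⟪y, v⟫_ℝ) * ⟪z, p⟫_ℝ +
      ⟪y, cross v p⟫_ℝ * ⟪z, cross v p⟫_ℝ) / ⟪cross v p, cross v p⟫_ℝ := by
  rw [eq_div_iff (inner_self_ne_zero.2 h), mul_comm, gram_inner]
  ring

/-- The product of the velocity of the next curve with the previous ruling depends affinely on the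
product of the rulings and on their determinant with the velocity of the middle curve. -/
lemma SameRibbon.inner_sub {c₁ c₂ d₁ d₂ c₀ d₀ : ℝ → E3} (h : SameRibbon a b c₁ c₂ d₁ d₂)
    (h' : SameRibbon a b c₁ c₀ d₁ d₀) {t : ℝ} (ht : t ∈ Icc a b)
    (hne : cross (dot a b c₁ t) (c₂ t - c₁ t) ≠ 0)
    (hne' : cross (dot a b d₁ t) (d₂ t - d₁ t) ≠ 0) :
    ⟪dot a b d₂ t, d₀ t - d₁ t⟫_ℝ - ⟪dot a b c₂ t, c₀ t - c₁ t⟫_ℝ =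
      (⟪dot a b c₁ t, dot a b c₁ t⟫_ℝ * ⟪dot a b c₂ t, c₂ t - c₁ t⟫_ℝ -
        ⟪dot a b c₁ t, c₂ t - c₁ t⟫_ℝ * ⟪dot a b c₂ t, dot a b c₁ t⟫_ℝ) /
          ⟪cross (dot a b c₁ t) (c₂ t - c₁ t), cross (dot a b c₁ t) (c₂ t - c₁ t)⟫_ℝ *
        (bend d₀ d₁ d₂ t - bend c₀ c₁ c₂ t) +
      ⟪dot a b c₂ t, cross (dot a b c₁ t) (c₂ t - c₁ t)⟫_ℝ /
          ⟪cross (dot a b c₁ t) (c₂ t - c₁ t), cross (dot a b c₁ t) (c₂ t - c₁ t)⟫_ℝ *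
        (vdet a b d₀ d₁ d₂ t - vdet a b c₀ c₁ c₂ t) := by
  have e1 : ⟪dot a b d₂ t, dot a b d₁ t⟫_ℝ = ⟪dot a b c₂ t, dot a b c₁ t⟫_ℝ := by
    rw [real_inner_comm, h.left_right t ht, real_inner_comm]
  have e2 : ⟪dot a b d₂ t, cross (dot a b d₁ t) (d₂ t - d₁ t)⟫_ℝ =
      ⟪dot a b c₂ t, cross (dot a b c₁ t) (c₂ t - c₁ t)⟫_ℝ := by
    rw [real_inner_comm, h.orient t ht, real_inner_comm]
  have e3 : ⟪d₀ t - d₁ t, dot a b d₁ t⟫_ℝ = ⟪c₀ t - c₁ t, dot a b c₁ t⟫_ℝ := by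
    rw [real_inner_comm, h'.left_ruling t ht, real_inner_comm]
  have e4 : ⟪cross (dot a b d₁ t) (d₂ t - d₁ t), cross (dot a b d₁ t) (d₂ t - d₁ t)⟫_ℝ =
      ⟪cross (dot a b c₁ t) (c₂ t - c₁ t), cross (dot a b c₁ t) (c₂ t - c₁ t)⟫_ℝ := by
    rw [inner_cross_cross, inner_cross_cross, real_inner_comm (dot a b d₁ t) (d₂ t - d₁ t),
      real_inner_comm (dot a b c₁ t) (c₂ t - c₁ t), h.left t ht, h.ruling t ht, h.left_ruling t ht]
  rw [inner_eq_of_frame (y := dot a b d₂ t) hne', inner_eq_of_frame (y := dot a b c₂ t) hne,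
    e1, e2, e3, e4, h.left t ht, h.ruling t ht, h.left_ruling t ht, h.right_ruling t ht, bend, bend,
    vdet, vdet, real_inner_comm (d₀ t - d₁ t) (cross _ _), real_inner_comm (c₀ t - c₁ t) (cross _ _),
    real_inner_comm (d₀ t - d₁ t) (d₂ t - d₁ t), real_inner_comm (c₀ t - c₁ t) (c₂ t - c₁ t)]
  ring

/-- If two isometric pairs of adjacent ribbons have the same angle at one moment, they have the
same angle at all moments. -/
theorem bend_eq_of_eq {c₀ c₁ c₂ d₀ d₁ d₂ : ℝ → E3} (hab : a < b)
    (hc₀ : ContDiffOn ℝ ∞ c₀ (Icc a b)) (hc₁ : ContDiffOn ℝ ∞ c₁ (Icc a b))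
    (hc₂ : ContDiffOn ℝ ∞ c₂ (Icc a b)) (hd₀ : ContDiffOn ℝ ∞ d₀ (Icc a b))
    (hd₁ : ContDiffOn ℝ ∞ d₁ (Icc a b)) (hd₂ : ContDiffOn ℝ ∞ d₂ (Icc a b))
    (h₀ : SameRibbon a b c₁ c₀ d₁ d₀) (h₂ : SameRibbon a b c₁ c₂ d₁ d₂)
    (hpos : ∀ t ∈ Icc a b, 0 < vdet a b d₀ d₁ d₂ t * vdet a b c₀ c₁ c₂ t)
    {r : ℝ} (hr : r ∈ Icc a b) (heq : bend d₀ d₁ d₂ r = bend c₀ c₁ c₂ r) :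
    ∀ t ∈ Icc a b, bend d₀ d₁ d₂ t = bend c₀ c₁ c₂ t := by
  have sv := contDiffOn_dot hab hc₁
  have sp := hc₂.sub hc₁
  have sq := hc₀.sub hc₁
  have sw := contDiffOn_dot hab hc₂
  have su := contDiffOn_dot hab hc₀
  have hcne : ∀ t ∈ Icc a b, vdet a b c₀ c₁ c₂ t ≠ 0 := fun t ht h => by
    have := hpos t ht; rw [h, mul_zero] at this; exact this.false
  have hdne : ∀ t ∈ Icc a b, vdet a b d₀ d₁ d₂ t ≠ 0 := fun t ht h => by
    have := hpos t ht; rw [h, zero_mul] at this; exact this.false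
  have hsum : ∀ t ∈ Icc a b, vdet a b d₀ d₁ d₂ t + vdet a b c₀ c₁ c₂ t ≠ 0 := fun t ht h => by
    have := hpos t ht
    rw [eq_neg_of_add_eq_zero_left h] at this
    nlinarith [sq_nonneg (vdet a b c₀ c₁ c₂ t)]
  have hne : ∀ (e₀ e₁ e₂ : ℝ → E3) (t : ℝ), vdet a b e₀ e₁ e₂ t ≠ 0 →
      cross (dot a b e₁ t) (e₂ t - e₁ t) ≠ 0 := fun e₀ e₁ e₂ t h h' => h (by
    rw [vdet, h', inner_zero_left])
  have hne2 : ∀ (e₀ e₁ e₂ : ℝ → E3) (t : ℝ), vdet a b e₀ e₁ e₂ t ≠ 0 →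
      cross (dot a b e₁ t) (e₀ t - e₁ t) ≠ 0 := fun e₀ e₁ e₂ t h => hne e₂ e₁ e₀ t (by
    rwa [vdet_comm, neg_ne_zero])
  -- the difference of the determinants in terms of the difference of the angles
  have hdiff : ∀ t ∈ Icc a b, vdet a b d₀ d₁ d₂ t - vdet a b c₀ c₁ c₂ t =
      (2 * ⟪dot a b c₁ t, c₂ t - c₁ t⟫_ℝ * ⟪dot a b c₁ t, c₀ t - c₁ t⟫_ℝ -
        ⟪dot a b c₁ t, dot a b c₁ t⟫_ℝ * (bend d₀ d₁ d₂ t + bend c₀ c₁ c₂ t)) /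
        (vdet a b d₀ d₁ d₂ t + vdet a b c₀ c₁ c₂ t) *
        (bend d₀ d₁ d₂ t - bend c₀ c₁ c₂ t) := by
    intro t ht
    rw [div_mul_eq_mul_div, eq_div_iff (hsum t ht)]
    have e1 : vdet a b d₀ d₁ d₂ t ^ 2 = _ := det_sq _ _ _
    have e2 : vdet a b c₀ c₁ c₂ t ^ 2 = _ := det_sq _ _ _
    rw [h₂.left t ht, h₂.ruling t ht, h₂.left_ruling t ht, h₀.ruling t ht, h₀.left_ruling t ht]
      at e1
    have e3 : ∀ x y : ℝ, (x - y) * (x + y) = x ^ 2 - y ^ 2 := fun x y => by ring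
    rw [e3, e1, e2, bend, bend]
    ring
  -- The derivative of a bend is ⟨ċ₂, c₀ - c₁⟩ + ⟨ċ₀, c₂ - c₁⟩ up to inner geometry, and both terms
  -- are affine in `bend` and `vdet` (`SameRibbon.inner_sub`). The difference of the two `vdet` is a
  -- multiple of the difference of the bends, since the squares are polynomials in the bend and the
  -- sum does not vanish. So the difference of the bends solves a homogeneous linear equation.
  have hzero := eq_zero_of_linear_ode (d := fun t => bend d₀ d₁ d₂ t - bend c₀ c₁ c₂ t)
    (c := fun t =>
      (⟪dot a b c₁ t, dot a b c₁ t⟫_ℝ * ⟪dot a b c₂ t, c₂ t - c₁ t⟫_ℝ -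
        ⟪dot a b c₁ t, c₂ t - c₁ t⟫_ℝ * ⟪dot a b c₂ t, dot a b c₁ t⟫_ℝ) /
          ⟪cross (dot a b c₁ t) (c₂ t - c₁ t), cross (dot a b c₁ t) (c₂ t - c₁ t)⟫_ℝ +
      (⟪dot a b c₁ t, dot a b c₁ t⟫_ℝ * ⟪dot a b c₀ t, c₀ t - c₁ t⟫_ℝ -
        ⟪dot a b c₁ t, c₀ t - c₁ t⟫_ℝ * ⟪dot a b c₀ t, dot a b c₁ t⟫_ℝ) /
          ⟪cross (dot a b c₁ t) (c₀ t - c₁ t), cross (dot a b c₁ t) (c₀ t - c₁ t)⟫_ℝ +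
      (⟪dot a b c₂ t, cross (dot a b c₁ t) (c₂ t - c₁ t)⟫_ℝ /
          ⟪cross (dot a b c₁ t) (c₂ t - c₁ t), cross (dot a b c₁ t) (c₂ t - c₁ t)⟫_ℝ -
        ⟪dot a b c₀ t, cross (dot a b c₁ t) (c₀ t - c₁ t)⟫_ℝ /
          ⟪cross (dot a b c₁ t) (c₀ t - c₁ t), cross (dot a b c₁ t) (c₀ t - c₁ t)⟫_ℝ) *
      ((2 * ⟪dot a b c₁ t, c₂ t - c₁ t⟫_ℝ * ⟪dot a b c₁ t, c₀ t - c₁ t⟫_ℝ -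
        ⟪dot a b c₁ t, dot a b c₁ t⟫_ℝ * (bend d₀ d₁ d₂ t + bend c₀ c₁ c₂ t)) /
        (vdet a b d₀ d₁ d₂ t + vdet a b c₀ c₁ c₂ t))) hr ?_ ?_ (sub_eq_zero.2 heq)
  · exact fun t ht => sub_eq_zero.1 (hzero t ht)
  · have cv := sv.continuousOn
    have cp := sp.continuousOn
    have cq := sq.continuousOn
    have cw := sw.continuousOn
    have cu := su.continuousOn
    have cn := (ContDiffOn.cross sv sp).continuousOn
    have cm := (ContDiffOn.cross sv sq).continuousOn
    have cbc : ContinuousOn (bend c₀ c₁ c₂) (Icc a b) := cp.inner cq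
    have cbd : ContinuousOn (bend d₀ d₁ d₂) (Icc a b) :=
      (hd₂.sub hd₁).continuousOn.inner (hd₀.sub hd₁).continuousOn
    have cdc : ContinuousOn (vdet a b c₀ c₁ c₂) (Icc a b) := cn.inner cq
    have cdd : ContinuousOn (vdet a b d₀ d₁ d₂) (Icc a b) :=
      (ContDiffOn.cross (contDiffOn_dot hab hd₁) (hd₂.sub hd₁)).continuousOn.inner
        (hd₀.sub hd₁).continuousOn
    have n1 : ∀ t ∈ Icc a b,
        ⟪cross (dot a b c₁ t) (c₂ t - c₁ t), cross (dot a b c₁ t) (c₂ t - c₁ t)⟫_ℝ ≠ 0 :=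
      fun t ht => inner_self_ne_zero.2 (hne c₀ c₁ c₂ t (hcne t ht))
    have n2 : ∀ t ∈ Icc a b,
        ⟪cross (dot a b c₁ t) (c₀ t - c₁ t), cross (dot a b c₁ t) (c₀ t - c₁ t)⟫_ℝ ≠ 0 :=
      fun t ht => inner_self_ne_zero.2 (hne2 c₀ c₁ c₂ t (hcne t ht))
    exact ((((cv.inner cv).mul (cw.inner cp)).sub ((cv.inner cp).mul (cw.inner cv))).div
        (cn.inner cn) n1).add ((((cv.inner cv).mul (cu.inner cq)).sub
        ((cv.inner cq).mul (cu.inner cv))).div (cm.inner cm) n2) |>.add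
      ((((cw.inner cn).div (cn.inner cn) n1).sub ((cu.inner cm).div (cm.inner cm) n2)).mul
        ((((continuousOn_const.mul (cv.inner cp)).mul (cv.inner cq)).sub
          ((cv.inner cv).mul (cbd.add cbc))).div (cdd.add cdc) hsum))
  · intro t ht
    have d1 := (hasDerivWithinAt_inner (hd₂.sub hd₁) (hd₀.sub hd₁) ht).sub
      (hasDerivWithinAt_inner (hc₂.sub hc₁) (hc₀.sub hc₁) ht)
    refine d1.congr_deriv ?_
    have k2 := h₂.inner_sub h₀ ht (hne c₀ c₁ c₂ t (hcne t ht)) (hne d₀ d₁ d₂ t (hdne t ht))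
    have k0 := h₀.inner_sub h₂ ht (hne2 c₀ c₁ c₂ t (hcne t ht)) (hne2 d₀ d₁ d₂ t (hdne t ht))
    rw [bend_comm d₂, bend_comm c₂, vdet_comm a b d₂, vdet_comm a b c₂] at k0
    have k3 := hdiff t ht
    have l2 := h₂.left_ruling t ht
    have l0 := h₀.left_ruling t ht
    simp only [dot_sub hab hd₂ hd₁ ht, dot_sub hab hd₀ hd₁ ht,
      dot_sub hab hc₂ hc₁ ht, dot_sub hab hc₀ hc₁ ht]
    have e1 : ∀ w u v p q : E3, ⟪w - v, q⟫_ℝ + ⟪p, u - v⟫_ℝ =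
        ⟪w, q⟫_ℝ + ⟪u, p⟫_ℝ - ⟪v, q⟫_ℝ - ⟪v, p⟫_ℝ := by
      intro w u v p q
      rw [inner_sub_left, inner_sub_right, real_inner_comm u p, real_inner_comm v p]
      ring
    rw [e1, e1]
    linear_combination k2 + k0 - l2 - l0 +
      (⟪dot a b c₂ t, cross (dot a b c₁ t) (c₂ t - c₁ t)⟫_ℝ /
          ⟪cross (dot a b c₁ t) (c₂ t - c₁ t), cross (dot a b c₁ t) (c₂ t - c₁ t)⟫_ℝ -
        ⟪dot a b c₀ t, cross (dot a b c₁ t) (c₀ t - c₁ t)⟫_ℝ /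
          ⟪cross (dot a b c₁ t) (c₀ t - c₁ t), cross (dot a b c₁ t) (c₀ t - c₁ t)⟫_ℝ) * k3

end Uniqueness
end Ribbon
namespace Ribbon

/-! ### Carrying a third ruling along a flexion. -/

section Extension
variable {a b : ℝ}

/-- The products of the ruling towards the second curve with itself and with the velocity and
the acceleration of the first curve agree. -/
structure SameRuling (a b : ℝ) (c d c' d' : ℝ → E3) : Prop where
  ruling : ∀ t ∈ Icc a b, ⟪d' t - c' t, d' t - c' t⟫_ℝ = ⟪d t - c t, d t - c t⟫_ℝ
  dot_ruling : ∀ t ∈ Icc a b, ⟪d' t - c' t, dot a b c' t⟫_ℝ = ⟪d t - c t, dot a b c t⟫_ℝ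
  acc_ruling : ∀ t ∈ Icc a b,
    ⟪d' t - c' t, dot a b (dot a b c') t⟫_ℝ = ⟪d t - c t, dot a b (dot a b c) t⟫_ℝ

lemma constRuling_of {I : Type*} {o : I} {c d : ℝ → E3} {c' d' : I → ℝ → E3}
    (h : ∀ i, SameRuling a b c d (c' i) (d' i)) : ConstRuling a b o c' d' where
  ruling i t ht := ((h i).ruling t ht).trans ((h o).ruling t ht).symm
  dot_ruling i t ht := ((h i).dot_ruling t ht).trans ((h o).dot_ruling t ht).symm
  acc_ruling i t ht := ((h i).acc_ruling t ht).trans ((h o).acc_ruling t ht).symm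

lemma IsoRibbon.sameRuling {c d c' d' : ℝ → E3} (hab : a < b) (h : IsoRibbon a b c d c' d')
    (hc : ContDiffOn ℝ ∞ c (Icc a b)) (hd : ContDiffOn ℝ ∞ d (Icc a b))
    (hc' : ContDiffOn ℝ ∞ c' (Icc a b)) (hd' : ContDiffOn ℝ ∞ d' (Icc a b)) :
    SameRuling a b c d c' d' := by
  refine ⟨h.ruling, fun t ht => ?_, fun t ht => ?_⟩
  · rw [real_inner_comm, h.left_ruling t ht, real_inner_comm]
  · have := deriv_unique hab ht h.left_ruling
      (hasDerivWithinAt_inner (contDiffOn_dot hab hc') (hd'.sub hc') ht)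
      (hasDerivWithinAt_inner (contDiffOn_dot hab hc) (hd.sub hc) ht)
    rw [dot_sub hab hd' hc' ht, dot_sub hab hd hc ht, inner_sub_right (dot a b c' t),
      inner_sub_right (dot a b c t), h.left t ht, h.left_right t ht] at this
    rw [real_inner_comm, real_inner_comm (dot a b (dot a b c) t)]
    linarith

lemma IsoRibbon.speed {c d c' d' : ℝ → E3} (h : IsoRibbon a b c d c' d') {t : ℝ}
    (ht : t ∈ Icc a b) : ⟪dot a b d' t - dot a b c' t, dot a b d' t - dot a b c' t⟫_ℝ =
      ⟪dot a b d t - dot a b c t, dot a b d t - dot a b c t⟫_ℝ := by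
  rw [real_inner_sub_sub_self, real_inner_sub_sub_self, h.left t ht, h.right t ht,
    real_inner_comm (dot a b c' t), h.left_right t ht,
    real_inner_comm (dot a b c t) (dot a b d t)]

/-- Differentiating ⟨d - c, ċ⟩ gives ⟨ċ, ḋ⟩, and differentiating |d - c|² gives ⟨ḋ, d - c⟩; the
speed of the ruling then gives |ḋ|. Thus, for a ruling carried along an isometrically deformed
curve, the speed is the one condition left to check. -/
lemma isoRibbon_of_sameRuling {c d c' d' : ℝ → E3} (hab : a < b) (h : SameRuling a b c d c' d')
    (hc : ContDiffOn ℝ ∞ c (Icc a b)) (hd : ContDiffOn ℝ ∞ d (Icc a b))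
    (hc' : ContDiffOn ℝ ∞ c' (Icc a b)) (hd' : ContDiffOn ℝ ∞ d' (Icc a b))
    (hl : ∀ t ∈ Icc a b, ⟪dot a b c' t, dot a b c' t⟫_ℝ = ⟪dot a b c t, dot a b c t⟫_ℝ)
    (hs : ∀ t ∈ Icc a b, ⟪dot a b d' t - dot a b c' t, dot a b d' t - dot a b c' t⟫_ℝ =
      ⟪dot a b d t - dot a b c t, dot a b d t - dot a b c t⟫_ℝ) : IsoRibbon a b c d c' d' := by
  have hlr : ∀ t ∈ Icc a b, ⟪dot a b c' t, dot a b d' t⟫_ℝ = ⟪dot a b c t, dot a b d t⟫_ℝ := by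
    intro t ht
    have := deriv_unique hab ht h.dot_ruling
      (hasDerivWithinAt_inner (hd'.sub hc') (contDiffOn_dot hab hc') ht)
      (hasDerivWithinAt_inner (hd.sub hc) (contDiffOn_dot hab hc) ht)
    rw [dot_sub hab hd' hc' ht, dot_sub hab hd hc ht, inner_sub_left (dot a b d' t),
      inner_sub_left (dot a b d t), hl t ht, h.acc_ruling t ht] at this
    rw [real_inner_comm, real_inner_comm (dot a b d t)]
    linarith
  have hdr : ∀ t ∈ Icc a b, ⟪dot a b c' t, d' t - c' t⟫_ℝ = ⟪dot a b c t, d t - c t⟫_ℝ := by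
    intro t ht
    rw [real_inner_comm, h.dot_ruling t ht, real_inner_comm]
  refine ⟨hl, fun t ht => ?_, h.ruling, hdr, fun t ht => ?_, hlr⟩
  · have := hs t ht
    rw [real_inner_sub_sub_self, real_inner_sub_sub_self, hl t ht,
      real_inner_comm (dot a b c' t), hlr t ht, real_inner_comm (dot a b c t) (dot a b d t)] at this
    linarith
  · have := deriv_unique hab ht h.ruling
      (hasDerivWithinAt_inner (hd'.sub hc') (hd'.sub hc') ht)
      (hasDerivWithinAt_inner (hd.sub hc) (hd.sub hc) ht)
    rw [dot_sub hab hd' hc' ht, dot_sub hab hd hc ht,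
      real_inner_comm (dot a b d' t - dot a b c' t) (d' t - c' t),
      real_inner_comm (dot a b d t - dot a b c t) (d t - c t), inner_sub_left (dot a b d' t),
      inner_sub_left (dot a b d t)] at this
    linarith [hdr t ht]

/-- The Gram determinant as a function of the products. -/
def gramDet (V S K α β γ : ℝ) : ℝ :=
  V * (K * γ - β ^ 2) - S * (S * γ - β * α) + α * (S * β - K * α)

/-- The Gram determinant is affine in |z|² with slope |x × y|² ≠ 0. -/
lemma norm_sq_of_gramDet {x y z : E3} {α β γ : ℝ} (hne : cross x y ≠ 0) (hx : ⟪z, x⟫_ℝ = α)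
    (hy : ⟪z, y⟫_ℝ = β)
    (hn : ⟪cross x y, z⟫_ℝ ^ 2 = gramDet ⟪x, x⟫_ℝ ⟪x, y⟫_ℝ ⟪y, y⟫_ℝ α β γ) : ⟪z, z⟫_ℝ = γ := by
  have hW : ⟪x, x⟫_ℝ * ⟪y, y⟫_ℝ - ⟪x, y⟫_ℝ * ⟪x, y⟫_ℝ ≠ 0 := by
    have := inner_self_ne_zero (𝕜 := ℝ).2 hne
    rwa [inner_cross_cross, real_inner_comm x y] at this
  rw [det_sq, gramDet, real_inner_comm z x, real_inner_comm z y, hx, hy] at hn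
  have : (⟪x, x⟫_ℝ * ⟪y, y⟫_ℝ - ⟪x, y⟫_ℝ * ⟪x, y⟫_ℝ) * (⟪z, z⟫_ℝ - γ) = 0 := by
    linear_combination hn
  exact sub_eq_zero.1 ((mul_eq_zero.1 this).resolve_left hW)

/-- A ruling can be carried along a deformation of its initial curve so that its products with
itself and with the velocity and the acceleration of the curve are preserved. -/
theorem exists_ruling {ε : ℝ} {c : ℝ → ℝ → E3} {c' d' : ℝ → E3} (hε : 0 < ε) (hab : a < b)
    (hc : JointSmooth a b ε c) (hd : ContDiffOn ℝ ∞ d' (Icc a b))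
    (hc' : ContDiffOn ℝ ∞ c' (Icc a b)) (h0 : ∀ t ∈ Icc a b, c 0 t = c' t)
    (hne : ∀ t ∈ Icc a b, adet a b c' d' t ≠ 0) :
    ∃ δ, 0 < δ ∧ δ ≤ ε ∧ ∃ d : ℝ → ℝ → E3, JointSmooth a b δ d ∧ (∀ t ∈ Icc a b, d 0 t = d' t) ∧
      ∀ l ∈ Icc 0 δ, SameRuling a b c' d' (c l) (d l) ∧
        ∀ t ∈ Icc a b, 0 < adet a b (c l) (d l) t * adet a b c' d' t := by
  have jw := hc.dot hε hab
  have jw1 := jw.dot hε hab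
  have jn := jw.cross jw1
  have sw := contDiffOn_dot hab hc'
  have sw1 := contDiffOn_dot hab sw
  have sr := hd.sub hc'
  set α : ℝ → ℝ := fun t => ⟪d' t - c' t, dot a b c' t⟫_ℝ with hα
  set β : ℝ → ℝ := fun t => ⟪d' t - c' t, dot a b (dot a b c') t⟫_ℝ with hβ
  set γ : ℝ → ℝ := fun t => ⟪d' t - c' t, d' t - c' t⟫_ℝ with hγ
  set N : ℝ → ℝ := adet a b c' d' with hN
  have sα : ContDiffOn ℝ ∞ α (Icc a b) := sr.inner ℝ sw
  have sβ : ContDiffOn ℝ ∞ β (Icc a b) := sr.inner ℝ sw1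
  have sγ : ContDiffOn ℝ ∞ γ (Icc a b) := sr.inner ℝ sr
  have sN : ContDiffOn ℝ ∞ N (Icc a b) := (ContDiffOn.cross sw sw1).inner ℝ sr
  -- The value that `adet`² must have for the carried ruling to keep its length.
  set D : ℝ → ℝ → ℝ := fun l t => gramDet ⟪dot a b (c l) t, dot a b (c l) t⟫_ℝ
    ⟪dot a b (c l) t, dot a b (dot a b (c l)) t⟫_ℝ
    ⟪dot a b (dot a b (c l)) t, dot a b (dot a b (c l)) t⟫_ℝ (α t) (β t) (γ t) with hD
  set W : ℝ → ℝ → ℝ := fun l t => ⟪cross (dot a b (c l) t) (dot a b (dot a b (c l)) t),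
    cross (dot a b (c l) t) (dot a b (dot a b (c l)) t)⟫_ℝ with hW
  have lift : ∀ {x : ℝ → ℝ}, ContDiffOn ℝ ∞ x (Icc a b) →
      ContDiffOn ℝ ∞ (fun p : ℝ × ℝ => x p.2) (Icc 0 ε ×ˢ Icc a b) := fun hx =>
    hx.comp contDiff_snd.contDiffOn fun p hp => hp.2
  have jα := lift sα
  have jβ := lift sβ
  have jγ := lift sγ
  have jN := lift sN
  have jD : ContDiffOn ℝ ∞ (fun p : ℝ × ℝ => D p.1 p.2) (Icc 0 ε ×ˢ Icc a b) :=
    (((jw.inner jw).mul (((jw1.inner jw1).mul jγ).sub (jβ.pow 2))).sub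
      ((jw.inner jw1).mul (((jw.inner jw1).mul jγ).sub (jβ.mul jα)))).add
      (jα.mul (((jw.inner jw1).mul jβ).sub ((jw1.inner jw1).mul jα)))
  have jW : ContDiffOn ℝ ∞ (fun p : ℝ × ℝ => W p.1 p.2) (Icc 0 ε ×ˢ Icc a b) := jn.inner jn
  have hN2 : ∀ t ∈ Icc a b, 0 < N t ^ 2 := fun t ht => by
    have := hne t ht
    positivity
  have hD0 : ∀ t ∈ Icc a b, D 0 t = N t ^ 2 := by
    intro t ht
    simp only [hD, hN, adet, det_sq, gramDet, dot_congr h0 ht, dot_dot_congr h0 ht, hα, hβ, hγ]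
    rw [real_inner_comm (dot a b c' t) (d' t - c' t),
      real_inner_comm (dot a b (dot a b c') t) (d' t - c' t)]
  have hW0 : ∀ t ∈ Icc a b, 0 < W 0 t := by
    intro t ht
    simp only [hW, dot_congr h0 ht, dot_dot_congr h0 ht]
    exact real_inner_self_pos.2 fun h => hne t ht (by simp only [hN, adet, h, inner_zero_left])
  obtain ⟨δ₁, hδ₁, hδ₁ε, hDpos⟩ := exists_shrink_pos (x := D) hε jD.continuousOn fun t ht => by
    rw [hD0 t ht]; exact hN2 t ht
  obtain ⟨δ₂, hδ₂, hδ₂ε, hWpos⟩ := exists_shrink_pos (x := W) hε jW.continuousOn hW0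
  set δ := min δ₁ δ₂ with hδ
  have hδε : δ ≤ ε := (min_le_left _ _).trans hδ₁ε
  have hsub : Icc 0 δ ×ˢ Icc a b ⊆ Icc 0 ε ×ˢ Icc a b :=
    prod_mono (Icc_subset_Icc_right hδε) Subset.rfl
  have hDp : ∀ l ∈ Icc 0 δ, ∀ t ∈ Icc a b, 0 < D l t := fun l hl =>
    hDpos l ⟨hl.1, hl.2.trans (min_le_left _ _)⟩
  have hWp : ∀ l ∈ Icc 0 δ, ∀ t ∈ Icc a b, W l t ≠ 0 := fun l hl t ht =>
    (hWpos l ⟨hl.1, hl.2.trans (min_le_right _ _)⟩ t ht).ne'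
  -- The square root of D with the sign of N, written so that it is smooth and equals N at parameter
  -- 0.
  set A : ℝ → ℝ → ℝ := fun l t => N t * √(D l t / N t ^ 2) with hA
  set P : ℝ → ℝ → E3 := fun l t => ofProducts (dot a b (c l) t) (dot a b (dot a b (c l)) t)
    (cross (dot a b (c l) t) (dot a b (dot a b (c l)) t)) (α t) (β t) (A l t) with hP
  have jA : ContDiffOn ℝ ∞ (fun p : ℝ × ℝ => A p.1 p.2) (Icc 0 δ ×ˢ Icc a b) :=
    (jN.mono hsub).mul ((((jD.mono hsub).div ((jN.mono hsub).pow 2)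
      fun p hp => (hN2 p.2 hp.2).ne')).sqrt
      fun p hp => (div_pos (hDp _ hp.1 _ hp.2) (hN2 p.2 hp.2)).ne')
  have jP : JointSmooth a b δ P :=
    ((jW.mono hsub).inv fun p hp => hWp _ hp.1 _ hp.2).smul
      ((((jα.mono hsub).smul ((jw1.cross jn).mono hδε)).add
        ((jβ.mono hsub).smul ((jn.cross jw).mono hδε))).add (jA.smul (jn.mono hδε)))
  have hPp := fun l (hl : l ∈ Icc 0 δ) t (ht : t ∈ Icc a b) =>
    inner_ofProducts (hWp l hl t ht) (α t) (β t) (A l t)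
  have hA2 : ∀ l ∈ Icc 0 δ, ∀ t ∈ Icc a b, A l t ^ 2 = D l t := by
    intro l hl t ht
    rw [hA]
    simp only [mul_pow]
    rw [Real.sq_sqrt (div_pos (hDp l hl t ht) (hN2 t ht)).le, mul_div_cancel₀ _ (hN2 t ht).ne']
  have hδ0 : 0 < δ := lt_min hδ₁ hδ₂
  refine ⟨δ, hδ0, hδε, fun l t => c l t + P l t, (hc.mono hδε).add jP, fun t ht => ?_,
    fun l hl => ⟨⟨fun t ht => ?_, fun t ht => ?_, fun t ht => ?_⟩, fun t ht => ?_⟩⟩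
  · have hl : (0 : ℝ) ∈ Icc 0 δ := ⟨le_rfl, hδ0.le⟩
    obtain ⟨e1, e2, e3⟩ := hPp 0 hl t ht
    have hA0 : A 0 t = N t := by
      simp only [hA, hD0 t ht, div_self (hN2 t ht).ne', Real.sqrt_one, mul_one]
    have : P 0 t = d' t - c' t := by
      refine eq_of_inner_eq (hWp 0 hl t ht) (e1.trans ?_) (e2.trans ?_) (e3.trans ?_)
      · rw [dot_congr h0 ht]
      · rw [dot_dot_congr h0 ht]
      · rw [hA0, dot_congr h0 ht, dot_dot_congr h0 ht, real_inner_comm]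
        rfl
    simp only [this, h0 t ht, add_sub_cancel]
  · obtain ⟨e1, e2, e3⟩ := hPp l hl t ht
    simp only [add_sub_cancel_left]
    refine norm_sq_of_gramDet (inner_self_ne_zero.1 (hWp l hl t ht)) e1 e2 ?_
    rw [real_inner_comm]
    exact (congrArg (· ^ 2) e3).trans (hA2 l hl t ht)
  · simp only [add_sub_cancel_left]
    exact (hPp l hl t ht).1
  · simp only [add_sub_cancel_left]
    exact (hPp l hl t ht).2.1
  · have e : adet a b (c l) (fun t => c l t + P l t) t = A l t := by
      simp only [adet, add_sub_cancel_left]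
      rw [real_inner_comm]
      exact (hPp l hl t ht).2.2
    rw [e, hA]
    have := Real.sqrt_pos.2 (div_pos (hDp l hl t ht) (hN2 t ht))
    have h2 := hN2 t ht
    calc (0 : ℝ) < N t ^ 2 * √(D l t / N t ^ 2) := mul_pos h2 this
      _ = N t * √(D l t / N t ^ 2) * N t := by ring

lemma mul_pos_of_mul_pos {x y f : ℝ} (hx : 0 < x * f) (hy : 0 < y * f) : 0 < x * y := by
  by_contra hn
  have h := mul_pos hx hy
  rw [show x * f * (y * f) = x * y * f ^ 2 by ring] at h
  exact absurd h (not_lt.2 (mul_nonpos_of_nonpos_of_nonneg (not_lt.1 hn) (sq_nonneg f)))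

/-- Data of a deformation of four curves that is isometric on the first two ribbons and preserves
the products of the third ruling with the velocity and the acceleration. -/
structure Deforms (a b ε : ℝ) (f₀ f₁ f₂ f₃ : ℝ → E3) (c₀ c₁ c₂ c₃ : ℝ → ℝ → E3) : Prop where
  pos : 0 < ε
  smooth₀ : JointSmooth a b ε c₀
  smooth₁ : JointSmooth a b ε c₁
  smooth₂ : JointSmooth a b ε c₂
  smooth₃ : JointSmooth a b ε c₃
  ribbon₀ : ∀ l ∈ Icc 0 ε, SameRibbon a b f₁ f₀ (c₁ l) (c₀ l)
  ribbon₁ : ∀ l ∈ Icc 0 ε, SameRibbon a b f₁ f₂ (c₁ l) (c₂ l)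
  ruling₂ : ∀ l ∈ Icc 0 ε, SameRuling a b f₂ f₃ (c₂ l) (c₃ l)
  vdet_pos : ∀ l ∈ Icc 0 ε, ∀ t ∈ Icc a b, 0 < vdet a b (c₀ l) (c₁ l) (c₂ l) t * vdet a b f₀ f₁ f₂ t
  adet_pos : ∀ l ∈ Icc 0 ε, ∀ t ∈ Icc a b, 0 < adet a b (c₂ l) (c₃ l) t * adet a b f₂ f₃ t
  bend_start : ∀ t ∈ Icc a b, bend (c₀ 0) (c₁ 0) (c₂ 0) t = bend f₀ f₁ f₂ t

/-- If the speed of the third ruling is constant in one deformation in which the first angle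
changes, it is constant in all deformations. -/
theorem Deforms.speed_eq {ε ε' t : ℝ} {f₀ f₁ f₂ f₃ : ℝ → E3} {c₀ c₁ c₂ c₃ e₀ e₁ e₂ e₃ : ℝ → ℝ → E3}
    (hab : a < b) (ht : t ∈ Icc a b)
    (hc : Deforms a b ε f₀ f₁ f₂ f₃ c₀ c₁ c₂ c₃) (he : Deforms a b ε' f₀ f₁ f₂ f₃ e₀ e₁ e₂ e₃)
    (hne : ∃ l ∈ Icc 0 ε', bend (e₀ l) (e₁ l) (e₂ l) t ≠ bend f₀ f₁ f₂ t)
    (hs : ∀ l ∈ Icc 0 ε', ⟪dot a b (e₃ l) t - dot a b (e₂ l) t,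
      dot a b (e₃ l) t - dot a b (e₂ l) t⟫_ℝ =
        ⟪dot a b f₃ t - dot a b f₂ t, dot a b f₃ t - dot a b f₂ t⟫_ℝ) {l : ℝ} (hl : l ∈ Icc 0 ε) :
    ⟪dot a b (c₃ l) t - dot a b (c₂ l) t, dot a b (c₃ l) t - dot a b (c₂ l) t⟫_ℝ =
      ⟪dot a b f₃ t - dot a b f₂ t, dot a b f₃ t - dot a b f₂ t⟫_ℝ := by
  -- Indexing by both parameter intervals at once makes the speeds in the two deformations values of
  -- one and the same analytic function of the bend.
  let I := Icc (0 : ℝ) ε ⊕ Icc (0 : ℝ) ε'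
  let o : I := Sum.inl ⟨0, le_rfl, hc.pos.le⟩
  let g : (ℝ → ℝ → E3) → (ℝ → ℝ → E3) → I → ℝ → E3 := fun c e =>
    Sum.elim (fun l => c l) (fun l => e l)
  have sg : ∀ {c e}, JointSmooth a b ε c → JointSmooth a b ε' e → IsSmooth a b (g c e) := by
    rintro c e h1 h2 (i | i)
    exacts [h1.slice i.2, h2.slice i.2]
  let h : I → ℝ := fun i => bend (g c₀ e₀ i) (g c₁ e₁ i) (g c₂ e₂ i) t
  have hA := isFieldlike_analyticIn h
  have hr₀ : ConstRibbon a b o (g c₁ e₁) (g c₀ e₀) := constRibbon_of (c := f₁) (d := f₀) (by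
    rintro (i | i)
    exacts [hc.ribbon₀ i i.2, he.ribbon₀ i i.2])
  have hr₁ : ConstRibbon a b o (g c₁ e₁) (g c₂ e₂) := constRibbon_of (c := f₁) (d := f₂) (by
    rintro (i | i)
    exacts [hc.ribbon₁ i i.2, he.ribbon₁ i i.2])
  have hr₂ : ConstRuling a b o (g c₂ e₂) (g c₃ e₃) := constRuling_of (c := f₂) (d := f₃) (by
    rintro (i | i)
    exacts [hc.ruling₂ i i.2, he.ruling₂ i i.2])
  have hbend : AnalyticIn h fun i => bend (g c₀ e₀ i) (g c₁ e₁ i) (g c₂ e₂ i) t :=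
    AnalyticIn.self h
  have hvpos : ∀ i, 0 < vdet a b (g c₀ e₀ i) (g c₁ e₁ i) (g c₂ e₂ i) t * vdet a b f₀ f₁ f₂ t := by
    rintro (i | i)
    exacts [hc.vdet_pos i i.2 t ht, he.vdet_pos i i.2 t ht]
  have hapos : ∀ i, 0 < adet a b (g c₂ e₂ i) (g c₃ e₃ i) t * adet a b f₂ f₃ t := by
    rintro (i | i)
    exacts [hc.adet_pos i i.2 t ht, he.adet_pos i i.2 t ht]
  have hv : AnalyticIn h fun i => vdet a b (g c₀ e₀ i) (g c₁ e₁ i) (g c₂ e₂ i) t :=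
    AnalyticIn.of_sq o (vdet_sq_mem ht hA hr₀ hr₁ hbend)
      fun i => mul_pos_of_mul_pos (hvpos i) (hvpos o)
  have hV : VertexKnown a b (AnalyticIn h) t (g c₀ e₀) (g c₁ e₁) (g c₂ e₂) :=
    vertexKnown hab ht hA (sg hc.smooth₀ he.smooth₀) (sg hc.smooth₁ he.smooth₁)
      (sg hc.smooth₂ he.smooth₂) hr₀ hr₁ hbend hv fun i => left_ne_zero_of_mul (hvpos i).ne'
  have ha : AnalyticIn h fun i => adet a b (g c₂ e₂ i) (g c₃ e₃ i) t :=
    AnalyticIn.of_sq o (hV.adet_sq_mem ht hr₂) fun i => mul_pos_of_mul_pos (hapos i) (hapos o)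
  have hE := hV.ruling_speed_mem hab ht (sg hc.smooth₂ he.smooth₂) (sg hc.smooth₃ he.smooth₃)
    hr₂ ha fun i => left_ne_zero_of_mul (hapos i).ne'
  have hbc := continuousOn_param (x := fun l t => bend (c₀ l) (c₁ l) (c₂ l) t)
    (continuousOn_bend hc.smooth₀ hc.smooth₁ hc.smooth₂) ht le_rfl
  have hbe := continuousOn_param (x := fun l t => bend (e₀ l) (e₁ l) (e₂ l) t)
    (continuousOn_bend he.smooth₀ he.smooth₁ he.smooth₂) ht le_rfl
  have hrange : range h = (fun l => bend (c₀ l) (c₁ l) (c₂ l) t) '' Icc 0 ε ∪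
      (fun l => bend (e₀ l) (e₁ l) (e₂ l) t) '' Icc 0 ε' := by
    ext x
    constructor
    · rintro ⟨i | i, rfl⟩
      exacts [Or.inl ⟨i, i.2, rfl⟩, Or.inr ⟨i, i.2, rfl⟩]
    · rintro (⟨l, hl, rfl⟩ | ⟨l, hl, rfl⟩)
      exacts [⟨Sum.inl ⟨l, hl⟩, rfl⟩, ⟨Sum.inr ⟨l, hl⟩, rfl⟩]
  -- Each deformation sweeps out an interval of bends, and both intervals contain the initial bend.
  have hconn : IsPreconnected (range h) := by
    rw [hrange]
    exact IsPreconnected.union (bend f₀ f₁ f₂ t)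
      ⟨0, ⟨le_rfl, hc.pos.le⟩, hc.bend_start t ht⟩ ⟨0, ⟨le_rfl, he.pos.le⟩, he.bend_start t ht⟩
      (isPreconnected_Icc.image _ hbc) (isPreconnected_Icc.image _ hbe)
  obtain ⟨l₁, hl₁, hn⟩ := hne
  -- By the intermediate value theorem the second deformation covers a whole interval of bends;
  -- there the speed is known.
  have hJ : uIcc (bend f₀ f₁ f₂ t) (bend (e₀ l₁) (e₁ l₁) (e₂ l₁) t) ⊆ h '' range Sum.inr := by
    rw [← he.bend_start t ht]
    have hu : uIcc 0 l₁ = Icc 0 l₁ := uIcc_of_le hl₁.1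
    have := intermediate_value_uIcc (a := 0) (b := l₁)
      (f := fun l => bend (e₀ l) (e₁ l) (e₂ l) t)
      (by rw [hu]; exact hbe.mono (Icc_subset_Icc_right hl₁.2))
    refine this.trans ?_
    rintro _ ⟨l, hl, rfl⟩
    rw [hu] at hl
    exact ⟨Sum.inr ⟨l, hl.1, hl.2.trans hl₁.2⟩, ⟨_, rfl⟩, rfl⟩
  have hlt : min (bend f₀ f₁ f₂ t) (bend (e₀ l₁) (e₁ l₁) (e₂ l₁) t) <
      max (bend f₀ f₁ f₂ t) (bend (e₀ l₁) (e₁ l₁) (e₂ l₁) t) := min_lt_max.2 hn.symm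
  exact hE.eq_of_eq_on hconn hlt hJ (k := ⟪dot a b f₃ t - dot a b f₂ t,
    dot a b f₃ t - dot a b f₂ t⟫_ℝ) (by rintro _ ⟨l, rfl⟩; exact hs l l.2) (Sum.inl ⟨l, hl⟩)

end Extension
end Ribbon
namespace Ribbon

/-! ### Extension by one ribbon. -/

section Step
variable {a b ε : ℝ} {k m n : ℕ} {F : ℕ → ℝ → E3} {γ : ℝ → ℕ → ℝ → E3}

/-- The square root that recovers `vdet` is analytic only away from zero. The determinant may vanish
later in a flexion, so the parameter is kept small. -/
lemma Flexes.exists_vdet_pos (h : Flexes a b ε k m F γ) (hF : Generic a b n F) (hmn : m ≤ n) {j : ℕ}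
    (hk : k ≤ j) (hj : j + 2 ≤ m) : ∃ δ, 0 < δ ∧ δ ≤ ε ∧ ∀ l ∈ Icc 0 δ, ∀ t ∈ Icc a b,
      0 < vdet a b (γ l j) (γ l (j + 1)) (γ l (j + 2)) t *
        vdet a b (F j) (F (j + 1)) (F (j + 2)) t := by
  have h1 := continuousOn_vdet h.pos hF.lt (h.smooth j hk (by omega))
    (h.smooth (j + 1) (by omega) (by omega)) (h.smooth (j + 2) (by omega) hj)
  have h2 : ContinuousOn (vdet a b (F j) (F (j + 1)) (F (j + 2))) (Icc a b) :=
    ((ContDiffOn.cross (contDiffOn_dot hF.lt (hF.smooth (j + 1) (by omega)))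
      ((hF.smooth (j + 2) (by omega)).sub (hF.smooth (j + 1) (by omega)))).inner ℝ
      ((hF.smooth j (by omega)).sub (hF.smooth (j + 1) (by omega)))).continuousOn
  refine exists_shrink_pos
    (x := fun l t => vdet a b (γ l j) (γ l (j + 1)) (γ l (j + 2)) t *
      vdet a b (F j) (F (j + 1)) (F (j + 2)) t) h.pos
    (h1.mul (h2.comp continuous_snd.continuousOn fun p hp => hp.2)) fun t ht => ?_
  rw [h.vdet_start hk hj ht]
  exact mul_self_pos.2 (hF.vdet_ne j (by omega) t ht)

lemma Flexes.exists_adet_pos (h : Flexes a b ε k m F γ) (hF : Generic a b n F) (hmn : m ≤ n) {j : ℕ}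
    (hk : k ≤ j + 1) (hj : j + 2 ≤ m) : ∃ δ, 0 < δ ∧ δ ≤ ε ∧ ∀ l ∈ Icc 0 δ, ∀ t ∈ Icc a b,
      0 < adet a b (γ l (j + 1)) (γ l (j + 2)) t * adet a b (F (j + 1)) (F (j + 2)) t := by
  have h1 := continuousOn_adet h.pos hF.lt (h.smooth (j + 1) hk (by omega))
    (h.smooth (j + 2) (by omega) hj)
  have s1 := hF.smooth (j + 1) (by omega)
  have d1 := contDiffOn_dot hF.lt s1
  have h2 : ContinuousOn (adet a b (F (j + 1)) (F (j + 2))) (Icc a b) :=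
    ((ContDiffOn.cross d1 (contDiffOn_dot hF.lt d1)).inner ℝ
      ((hF.smooth (j + 2) (by omega)).sub s1)).continuousOn
  refine exists_shrink_pos
    (x := fun l t => adet a b (γ l (j + 1)) (γ l (j + 2)) t *
      adet a b (F (j + 1)) (F (j + 2)) t) h.pos
    (h1.mul (h2.comp continuous_snd.continuousOn fun p hp => hp.2)) fun t ht => ?_
  rw [h.adet_start hk hj ht]
  exact mul_self_pos.2 (hF.adet_ne j (by omega) t ht)

/-- A flexion of the curves `F 0, …, F (j + 2)` extends to the next curve for small parameters if
the last three ribbons have a flexion. -/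
theorem Flexes.exists_extension {j : ℕ} {ε' : ℝ} {γ' : ℝ → ℕ → ℝ → E3} (hF : Generic a b n F)
    (hjn : j + 3 ≤ n) (h : Flexes a b ε 0 (j + 2) F γ) (h' : Flexes a b ε' j (j + 3) F γ')
    (hmov : Moving a b ε' F γ' j) :
    ∃ (δ : ℝ) (Γ : ℝ → ℕ → ℝ → E3), δ ≤ ε ∧ Flexes a b δ 0 (j + 3) F Γ ∧
      ∀ l, ∀ i ≤ j + 2, Γ l i = γ l i := by
  have hab := hF.lt
  have f0 := hF.smooth j (by omega)
  have f1 := hF.smooth (j + 1) (by omega)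
  have f2 := hF.smooth (j + 2) (by omega)
  have f3 := hF.smooth (j + 3) (by omega)
  -- the given flexion of the last three ribbons
  obtain ⟨δ₁, hδ₁, hδ₁ε, hv₁⟩ := h'.exists_vdet_pos hF hjn le_rfl (by omega)
  obtain ⟨δ₂, hδ₂, hδ₂ε, ha₂⟩ := h'.exists_adet_pos hF hjn (j := j + 1) (by omega) le_rfl
  -- Immediate motion is used here: the bend has to change before either determinant can vanish.
  obtain ⟨l₁, hl₁, hlδ, t₁, ht₁, hne₁⟩ := hmov (min δ₁ δ₂) (lt_min hδ₁ hδ₂)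
  have hm := h'.mono (lt_min hδ₁ hδ₂) ((min_le_left _ _).trans hδ₁ε)
  have hl₁' : l₁ ∈ Icc 0 (min δ₁ δ₂) := ⟨hl₁.1, hlδ⟩
  have D' : Deforms a b (min δ₁ δ₂) (F j) (F (j + 1)) (F (j + 2)) (F (j + 3)) (fun l => γ' l j)
      (fun l => γ' l (j + 1)) (fun l => γ' l (j + 2)) (fun l => γ' l (j + 3)) := by
    have g2 := hm.smooth (j + 2) (by omega) (by omega)
    have g3 := hm.smooth (j + 3) (by omega) le_rfl
    exact
    { pos := hm.pos
      smooth₀ := hm.smooth j le_rfl (by omega)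
      smooth₁ := hm.smooth (j + 1) (by omega) (by omega)
      smooth₂ := g2
      smooth₃ := g3
      ribbon₀ := fun l hl => (hm.same hab le_rfl (by omega) hl).symm
      ribbon₁ := fun l hl => hm.same hab (by omega) (by omega) hl
      ruling₂ := fun l hl => (hm.iso (j + 2) (by omega) (by omega) l hl).sameRuling hab f2 f3
        (g2.slice hl) (g3.slice hl)
      vdet_pos := fun l hl => hv₁ l ⟨hl.1, hl.2.trans (min_le_left _ _)⟩
      adet_pos := fun l hl => ha₂ l ⟨hl.1, hl.2.trans (min_le_right _ _)⟩
      bend_start := fun t ht => hm.bendAt_start le_rfl (by omega) ht }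
  -- The identity theorem is applied at each t separately, so a change at t₁ must be spread to all
  -- times.
  have hne : ∀ t ∈ Icc a b, bendAt (γ' l₁) j t ≠ bendAt F j t := by
    intro t ht heq
    exact hne₁ (bend_eq_of_eq hab f0 f1 f2 (D'.smooth₀.slice hl₁') (D'.smooth₁.slice hl₁')
      (D'.smooth₂.slice hl₁') (D'.ribbon₀ l₁ hl₁') (D'.ribbon₁ l₁ hl₁') (D'.vdet_pos l₁ hl₁')
      ht heq t₁ ht₁)
  -- the new curve
  obtain ⟨δ₃, hδ₃, hδ₃ε, hv₃⟩ := h.exists_vdet_pos hF (by omega) (j := j) (by omega) le_rfl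
  obtain ⟨δ₄, hδ₄, hδ₄ε, d, hd, hd0, hds⟩ := exists_ruling h.pos hab
    (h.smooth (j + 2) (by omega) le_rfl) f3 f2 (h.start (j + 2) (by omega) le_rfl)
    (hF.adet_ne (j + 1) hjn)
  set δ := min δ₃ δ₄ with hδ
  have hδ0 : 0 < δ := lt_min hδ₃ hδ₄
  have hδε : δ ≤ ε := (min_le_left _ _).trans hδ₃ε
  have hM := h.mono hδ0 hδε
  have hd' : JointSmooth a b δ d := hd.mono (min_le_right _ _)
  have g2 := hM.smooth (j + 2) (by omega) le_rfl
  have h4 : ∀ l ∈ Icc 0 δ, l ∈ Icc 0 δ₄ := fun l hl => ⟨hl.1, hl.2.trans (min_le_right _ _)⟩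
  have D : Deforms a b δ (F j) (F (j + 1)) (F (j + 2)) (F (j + 3)) (fun l => γ l j)
      (fun l => γ l (j + 1)) (fun l => γ l (j + 2)) d :=
    { pos := hδ0
      smooth₀ := hM.smooth j (by omega) (by omega)
      smooth₁ := hM.smooth (j + 1) (by omega) (by omega)
      smooth₂ := g2
      smooth₃ := hd'
      ribbon₀ := fun l hl => (hM.same hab (by omega) (by omega) hl).symm
      ribbon₁ := fun l hl => hM.same hab (by omega) (by omega) hl
      ruling₂ := fun l hl => (hds l (h4 l hl)).1
      vdet_pos := fun l hl => hv₃ l ⟨hl.1, hl.2.trans (min_le_left _ _)⟩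
      adet_pos := fun l hl => (hds l (h4 l hl)).2
      bend_start := fun t ht => hM.bendAt_start (by omega) le_rfl ht }
  have hiso : ∀ l ∈ Icc 0 δ, IsoRibbon a b (F (j + 2)) (F (j + 3)) (γ l (j + 2)) (d l) :=
    fun l hl => isoRibbon_of_sameRuling hab (D.ruling₂ l hl) f2 f3 (g2.slice hl) (hd'.slice hl)
      (hM.iso (j + 1) (by omega) (by omega) l hl).right fun t ht =>
        D.speed_eq hab ht D' ⟨l₁, hl₁', hne t ht⟩
          (fun l hl => (hm.iso (j + 2) (by omega) (by omega) l hl).speed ht) hl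
  refine ⟨δ, fun l i => if i ≤ j + 2 then γ l i else d l, hδε, ⟨hδ0, ?_, ?_, ?_⟩, ?_⟩
  · intro i _ hi
    by_cases h1 : i ≤ j + 2
    · simpa only [h1, if_true] using hM.smooth i (by omega) h1
    · simpa only [h1, if_false] using hd'
  · intro i _ hi t ht
    by_cases h1 : i ≤ j + 2
    · simpa only [h1, if_true] using hM.start i (by omega) h1 t ht
    · obtain rfl : i = j + 3 := by omega
      simpa only [h1, if_false] using hd0 t ht
  · intro i _ hi l hl
    by_cases h1 : i + 1 ≤ j + 2
    · simpa only [h1, show i ≤ j + 2 by omega, if_true] using hM.iso i (by omega) (by omega) l hl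
    · obtain rfl : i = j + 2 := by omega
      simpa only [h1, le_refl, if_true, if_false] using hiso l hl
  · intro l i hi
    simp only [hi, if_true]

end Step

/-! ### Induction along the chain. -/

/-- The curves `F k, …, F m` have a flexion that changes the first angle. -/
def FlexibleChain (a b : ℝ) (k m : ℕ) (F : ℕ → ℝ → E3) : Prop :=
  ∃ (ε : ℝ) (γ : ℝ → ℕ → ℝ → E3), Flexes a b ε k m F γ ∧
    ∃ l ∈ Icc 0 ε, ∃ t ∈ Icc a b, bendAt (γ l) k t ≠ bendAt F k t

/-- Restriction works because a constant bend would propagate back to the first one. For the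
converse the ribbons are added one at a time; each added 3-ribbon piece must move immediately at its
own first fold, while the flexion being extended only has to keep moving at fold 0. -/
theorem flexibleChain_iff {a b : ℝ} {n : ℕ} {F : ℕ → ℝ → E3} (hn : 3 ≤ n)
    (hF : Generic a b n F) :
    FlexibleChain a b 0 n F ↔ ∀ k, k + 3 ≤ n → FlexibleChain a b k (k + 3) F := by
  constructor
  · rintro ⟨ε, γ, h, l, hl, t, ht, hne⟩ k hk
    refine ⟨ε, γ, h.restrict (Nat.zero_le _) hk, ?_⟩
    by_contra! hcon
    exact hne (h.still_all hF le_rfl (s := ε) (right_mem_Icc.2 h.pos.le) (j := k) (by omega)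
      (by omega) (fun l hl t ht => hcon l hl t ht) le_rfl (by omega) l hl t ht)
  · intro h
    have hmov : ∀ k, k + 3 ≤ n → ∃ (ε : ℝ) (γ : ℝ → ℕ → ℝ → E3), Flexes a b ε k (k + 3) F γ ∧
        Flexes.Moving a b ε F γ k := fun k hk =>
      let ⟨_, _, h1, hne⟩ := h k hk
      h1.exists_moving hF hk le_rfl (by omega) hne
    have hall : ∀ j, j + 3 ≤ n → ∃ (ε : ℝ) (γ : ℝ → ℕ → ℝ → E3), Flexes a b ε 0 (j + 3) F γ ∧
        Flexes.Moving a b ε F γ 0 := by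
      intro j
      induction j with
      | zero => exact hmov 0
      | succ j ih =>
        intro hj
        obtain ⟨ε, γ, h1, h2⟩ := ih (by omega)
        obtain ⟨ε', γ', h1', h2'⟩ := hmov (j + 1) hj
        obtain ⟨δ, Γ, hδ, hΓ, heq⟩ := Flexes.exists_extension hF hj h1 h1' h2'
        refine ⟨δ, Γ, hΓ, fun r hr => ?_⟩
        -- The extension may shorten the parameter interval; motion at arbitrarily small parameters
        -- survives this.
        obtain ⟨l, hl, hlr, t, ht, hne⟩ := h2 (min r δ) (lt_min hr hΓ.pos)
        refine ⟨l, ⟨hl.1, hlr.trans (min_le_right _ _)⟩, hlr.trans (min_le_left _ _), t, ht, ?_⟩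
        rwa [bendAt, heq l 0 (by omega), heq l (0 + 1) (by omega), heq l (0 + 2) (by omega)]
    obtain ⟨j, rfl⟩ := Nat.exists_eq_add_of_le' hn
    obtain ⟨ε, γ, h1, h2⟩ := hall j le_rfl
    obtain ⟨l, hl, _, ht⟩ := h2 1 one_pos
    exact ⟨ε, γ, h1, l, hl, ht⟩

/-! ### Translation to the definitions of the statement. -/

section Bridge
variable {a b : ℝ} {n : ℕ}

lemma SameInnerGeometry.isoRibbon {f g : Fin (n + 1) → ℝ → E3} (h : SameInnerGeometry a b f g)
    (i : Fin n) : IsoRibbon a b (f i.castSucc) (f i.succ) (g i.castSucc) (g i.succ) where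
  left t ht := by rw [real_inner_self_eq_norm_sq, real_inner_self_eq_norm_sq, h.norm_dot _ t ht]
  right t ht := by rw [real_inner_self_eq_norm_sq, real_inner_self_eq_norm_sq, h.norm_dot _ t ht]
  ruling t ht := by
    have := h.norm_delta i t ht
    rw [real_inner_self_eq_norm_sq, real_inner_self_eq_norm_sq]
    exact congrArg (· ^ 2) this
  left_ruling := h.inner_dot_delta i
  right_ruling := h.inner_dot_delta_prev i
  left_right := h.inner_dot_dot i

lemma sameInnerGeometry_of_isoRibbon (hn : 0 < n) {f g : Fin (n + 1) → ℝ → E3}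
    (h : ∀ i : Fin n, IsoRibbon a b (f i.castSucc) (f i.succ) (g i.castSucc) (g i.succ)) :
    SameInnerGeometry a b f g where
  norm_dot i t ht := by
    rw [norm_eq_sqrt_real_inner, norm_eq_sqrt_real_inner (dot a b (f i) t)]
    congr 1
    -- The first curve is the left edge of ribbon 0; every other curve is the right edge of a
    -- ribbon.
    refine Fin.cases ?_ (fun j => ?_) i
    · exact (h ⟨0, hn⟩).left t ht
    · exact (h j).right t ht
  norm_delta i t ht := by
    rw [norm_eq_sqrt_real_inner, norm_eq_sqrt_real_inner (delta f i t)]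
    exact congrArg _ ((h i).ruling t ht)
  inner_dot_delta_prev i := (h i).right_ruling
  inner_dot_delta i := (h i).left_ruling
  inner_dot_dot i := (h i).left_right

lemma Congruent.bendAt_eq {F G : ℕ → ℝ → E3} {k : ℕ} (T : E3 ≃ᵃⁱ[ℝ] E3) {t : ℝ}
    (h : ∀ i, k ≤ i → i ≤ k + 2 → G i t = T (F i t)) : bendAt G k t = bendAt F k t := by
  have e : ∀ x y : E3, T x - T y = T.linearIsometryEquiv (x - y) := fun x y => by
    have := T.map_vsub x y
    simpa using this.symm
  rw [bendAt, bendAt, bend, bend, h k le_rfl (by omega), h (k + 1) (by omega) (by omega),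
    h (k + 2) (by omega) le_rfl, e, e, LinearIsometryEquiv.inner_map_map]

/-- The curves of a surface, indexed by the natural numbers. -/
def chain (f : Fin (n + 1) → ℝ → E3) (i : ℕ) : ℝ → E3 := f (Fin.ofNat (n + 1) i)

lemma chain_eq (f : Fin (n + 1) → ℝ → E3) {i : ℕ} (hi : i < n + 1) : chain f i = f ⟨i, hi⟩ :=
  congrArg f (Fin.ext (Nat.mod_eq_of_lt hi))

/-- Isometries of space preserve bends, so a changed bend excludes congruence. Conversely, if the
first bend is constant up to a parameter, the surface there is the image of the original under a
motion. -/
theorem flexible_sub_iff {f : Fin (n + 1) → ℝ → E3} (hF : Generic a b n (chain f)) {k m : ℕ}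
    (hm : 2 ≤ m) (h : k + m ≤ n) :
    Flexible a b (sub f k m h) ↔ FlexibleChain a b k (k + m) (chain f) := by
  have hsub : ∀ (i : ℕ) (hi : i < m + 1), sub f k m h ⟨i, hi⟩ = chain f (k + i) := fun i hi =>
    (chain_eq f (by omega)).symm
  constructor
  · rintro ⟨ε, γ, hγ, l, hl, hne⟩
    have hG : Flexes a b ε k (k + m) (chain f) (fun l i => chain (γ l) (i - k)) := by
      refine ⟨hγ.pos, fun i h1 h2 => ?_, fun i h1 h2 t ht => ?_, fun i h1 h2 l hl => ?_⟩
      · exact hγ.smooth _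
      · obtain ⟨i, rfl⟩ := Nat.exists_eq_add_of_le h1
        rw [Nat.add_sub_cancel_left, chain_eq _ (by omega), hγ.start _ t ht, hsub]
      · obtain ⟨i, rfl⟩ := Nat.exists_eq_add_of_le h1
        have := (hγ.isometric l hl).isoRibbon ⟨i, by omega⟩
        simp only [Fin.castSucc_mk, Fin.succ_mk, hsub] at this
        rw [Nat.add_sub_cancel_left, show k + i + 1 - k = i + 1 by omega,
          chain_eq (γ l) (i := i) (by omega), chain_eq (γ l) (i := i + 1) (by omega)]
        exact this
    refine ⟨ε, _, hG, ?_⟩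
    by_contra! hcon
    obtain ⟨T, τ, hT⟩ := hG.exists_motion hF h hl (j := k) le_rfl (by omega)
      fun l' hl' t ht => hcon l' ⟨hl'.1, hl'.2.trans hl.2⟩ t ht
    refine hne ⟨T.toAffineIsometryEquiv.trans (AffineIsometryEquiv.constVAdd ℝ E3 τ), ?_⟩
    rintro ⟨i, hi⟩ t ht
    have := hT (k + i) (by omega) (by omega) t ht
    rw [Nat.add_sub_cancel_left, chain_eq _ hi, ← hsub i hi] at this
    rw [this]
    simp [add_comm]
  · rintro ⟨ε, γ, hγ, l, hl, t, ht, hne⟩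
    refine ⟨ε, fun l j => γ l (k + j), ⟨⟨hγ.pos, fun i => ?_, fun i t ht => ?_⟩, fun l hl => ?_⟩,
      l, hl, ?_⟩
    · exact hγ.smooth _ (by omega) (by omega)
    · exact (hγ.start _ (by omega) (by omega) t ht).trans (congrFun (hsub i i.2) t).symm
    · refine sameInnerGeometry_of_isoRibbon (by omega) ?_
      rintro ⟨i, hi⟩
      simp only [Fin.castSucc_mk, Fin.succ_mk, hsub]
      exact hγ.iso (k + i) (by omega) (by omega) l hl
    · rintro ⟨T, hT⟩
      refine hne (Congruent.bendAt_eq T fun i h1 h2 => ?_)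
      obtain ⟨i, rfl⟩ := Nat.exists_eq_add_of_le h1
      rw [← hsub i (by omega)]
      exact hT ⟨i, by omega⟩ t ht

end Bridge

end Ribbon

theorem mainTheorem5 (n : ℕ) (hn : 3 ≤ n) (a b : ℝ) (f : Fin (n + 1) → ℝ → E3)
    (hf : Ribbon.IsSurface a b f)
    -- `ḟ_j`, `Δ f_{j-1}`, `Δ f_j` are nowhere coplanar, for `1 ≤ j ≤ n - 1`
    (hgen : ∀ i j : Fin n, i.val + 1 = j.val → ∀ t ∈ Set.Icc a b,
      LinearIndependent ℝ
        ![Ribbon.dot a b (f j.castSucc) t, Ribbon.delta f i t, Ribbon.delta f j t])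
    -- `(ḟ_j, f̈_j, Δ f_j)` vanishes nowhere, for `1 ≤ j ≤ n - 1`
    (hcurv : ∀ j : Fin n, 0 < j.val → ∀ t ∈ Set.Icc a b,
      LinearIndependent ℝ
        ![Ribbon.dot a b (f j.castSucc) t,
          Ribbon.dot a b (Ribbon.dot a b (f j.castSucc)) t, Ribbon.delta f j t]) :
    Ribbon.Flexible a b f ↔
      ∀ (k : ℕ) (hk : k + 3 ≤ n), Ribbon.Flexible a b (Ribbon.sub f k 3 hk) := by
  have hF : Ribbon.Generic a b n (Ribbon.chain f) := by
    refine ⟨hf.lt, fun i _ => hf.smooth _, fun i hi t ht => ?_, fun i hi t ht => ?_⟩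
    · have := Ribbon.det_ne_zero_of_linearIndependent
        (hgen ⟨i, by omega⟩ ⟨i + 1, by omega⟩ rfl t ht)
      -- `vdet` takes the rulings in the opposite order, and the previous one with the opposite
      -- sign.
      rw [Ribbon.det_swap, neg_ne_zero] at this
      rw [Ribbon.vdet, Ribbon.chain_eq f (by omega), Ribbon.chain_eq f (by omega),
        Ribbon.chain_eq f (by omega), ← neg_sub (f ⟨i + 1, by omega⟩ t) (f ⟨i, by omega⟩ t), inner_neg_right, neg_ne_zero]
      exact this
    · have := Ribbon.det_ne_zero_of_linearIndependent
        (hcurv ⟨i + 1, by omega⟩ (Nat.succ_pos i) t ht)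
      rw [Ribbon.adet, Ribbon.chain_eq f (by omega), Ribbon.chain_eq f (by omega)]
      exact this
  -- The whole surface is its own subsurface with k = 0 and m = n, so `flexible_sub_iff` translates
  -- both sides.
  have h0 : Ribbon.sub f 0 n (Nat.zero_add n).le = f :=
    funext fun j => congrArg f (Fin.ext (Nat.zero_add _))
  have h1 := Ribbon.flexible_sub_iff hF (by omega) (Nat.zero_add n).le
  rw [h0, Nat.zero_add] at h1
  rw [h1, Ribbon.flexibleChain_iff hn hF]
  exact forall₂_congr fun k hk => (Ribbon.flexible_sub_iff hF (by omega) hk).symm
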